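/- For a real $n\times N$ matrix $A$ and $T\subset\{1,\dots,N\}$ let $A_T$ be the submatrix of the columns of $A$ indexed by $T$, let $\|\cdot\|_2$ be the spectral norm, and for $S\subset\{1,\dots,N\}$ put $$\delta^*(S)=\max_{\ell\notin S}\bigl\|A_{S\cup\{\ell\}}^*A_{S\cup\{\ell\}}-I\bigr\|_2$$ (the maximum over the empty set, which occurs only for $S=\{1,\dots,N\}$, being $0$). **Proposition.** Let $\delta_0\in(0,1)$. There is a constant $C_1>0$ depending only on $\delta_0$ such that the following holds. Let $n,N,k$ be nonnegative integers, let $S\subset\{1,\dots,N\}$ have cardinality $k$, let $0<\delta\le\delta_0$ and $\varepsilon>0$, and let $A=\frac1{\sqrt n}\Phi$, where $\Phi$ is a random real $n\times N$ matrix whose entries are either independent standard Gaussian variables, or independent Bernoulli variables (taking the values $\pm1$ with probability $1/2$ each). If $$n\ \ge\ C_1\,\delta^{-2}\max\{k\log(1/\delta),\ \log(N/\varepsilon)\}$$ (with the convention $\log(0/\varepsilon)=0$ if $N=0$), then $\delta^*(S)\le\delta$ with probability at least $1-\varepsilon$. The same statement holds, with a possibly different constant $C_2>0$ depending only on $\delta_0$,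 for a random matrix $A\in\mathbb R^{n\times N}$ whose columns are independent and uniformly distributed on the unit sphere $S^{n-1}$ of $\mathbb R^n$. -/

import Mathlib

open MeasureTheory ProbabilityTheory
open scoped Matrix ENNReal

noncomputable section

/-- The submatrix `A_T` of `A` consisting of the columns indexed by `T`. -/
def colSubmatrix {n N : ℕ} (A : Matrix (Fin n) (Fin N) ℝ) (T : Finset (Fin N)) :
    Matrix (Fin n) T ℝ :=
  A.submatrix id Subtype.val

/-- The spectral norm of a square real matrix: its operator norm on Euclidean space. -/
def specNorm {ι : Type*} [Fintype ι] [DecidableEq ι] (M : Matrix ι ι ℝ) : ℝ :=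
  ‖Matrix.toEuclideanCLM (n := ι) (𝕜 := ℝ) M‖

/-- `δ(T) = ‖A_T^* A_T - I‖₂` (the adjoint of a real matrix is its transpose). -/
def isoConst {n N : ℕ} (A : Matrix (Fin n) (Fin N) ℝ) (T : Finset (Fin N)) : ℝ :=
  specNorm ((colSubmatrix A T)ᵀ * colSubmatrix A T - 1)

/-- `δ*(S) = max_{ℓ ∉ S} δ(S ∪ {ℓ})`, a maximum over a finite index set
(which is read as `0` when `S` is the whole index set). -/
def deltaStar {n N : ℕ} (A : Matrix (Fin n) (Fin N) ℝ) (S : Finset (Fin N)) : ℝ :=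
  ⨆ ℓ : {ℓ : Fin N // ℓ ∉ S}, isoConst A (insert ℓ.1 S)

/-- The entries of the random matrix `Φ` are independent standard normal variables. -/
def IsGaussianMatrix {Ω : Type*} [MeasurableSpace Ω] (μ : Measure Ω) {n N : ℕ}
    (Φ : Ω → Matrix (Fin n) (Fin N) ℝ) : Prop :=
  (∀ i j, HasLaw (fun ω => Φ ω i j) (gaussianReal 0 1) μ) ∧
    iIndepFun (fun (p : Fin n × Fin N) (ω : Ω) => Φ ω p.1 p.2) μ

/-- The symmetric Bernoulli distribution: `1` and `-1` with probability `1/2` each. -/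
def signMeasure : Measure ℝ :=
  (2⁻¹ : ℝ≥0∞) • Measure.dirac (1 : ℝ) + (2⁻¹ : ℝ≥0∞) • Measure.dirac (-1 : ℝ)

/-- The entries of the random matrix `Φ` are independent symmetric `±1` variables. -/
def IsBernoulliMatrix {Ω : Type*} [MeasurableSpace Ω] (μ : Measure Ω) {n N : ℕ}
    (Φ : Ω → Matrix (Fin n) (Fin N) ℝ) : Prop :=
  (∀ i j, HasLaw (fun ω => Φ ω i j) signMeasure μ) ∧
    iIndepFun (fun (p : Fin n × Fin N) (ω : Ω) => Φ ω p.1 p.2) μ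

/-- The uniform distribution on the unit sphere of `ℝⁿ`: the normalized surface measure,
regarded as a measure on `ℝⁿ`. -/
def uniformSphere (n : ℕ) : Measure (EuclideanSpace ℝ (Fin n)) :=
  let σ := (volume : Measure (EuclideanSpace ℝ (Fin n))).toSphere
  ((σ Set.univ)⁻¹ • σ).map Subtype.val

/-- The columns of the random matrix `A` are independent and uniformly distributed on the
unit sphere of `ℝⁿ`. -/
def IsSphericalMatrix {Ω : Type*} [MeasurableSpace Ω] (μ : Measure Ω) {n N : ℕ}
    (A : Ω → Matrix (Fin n) (Fin N) ℝ) : Prop :=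
  (∀ j, HasLaw (fun ω => (WithLp.toLp 2 fun i => A ω i j : EuclideanSpace ℝ (Fin n)))
      (uniformSphere n) μ) ∧
    iIndepFun (fun (j : Fin N) (ω : Ω) =>
      (WithLp.toLp 2 fun i => A ω i j : EuclideanSpace ℝ (Fin n))) μ

end

/-! Fix `T` with `k + 1` elements. By polarization and a half-net of the unit sphere, the norm of
the Gram deviation is controlled by its quadratic form at no more than `2 * 25 ^ (k + 1)` vectors
(`exists_test_vectors_specNorm`). At each vector the form is a centred sum of `n` independent
squares of sub-Gaussian variables with second moment one, up to scaling, so Bernstein's inequality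
(`exists_sum_sq_tail`) gives a tail `2 * exp (-c n δ²)`. Summing over test vectors and over the at
most `N` augmentations of `S` bounds the failure probability by `N * 4 * 25 ^ (k + 1) * exp (-c n
δ²)`. Since `log (1/δ) ≥ log (1/δ₀) > 0`, the term `k log (1/δ)` in the sample size beats `25 ^ k`.
The term `log (N/ε)` beats the rest, numerical factors included, as soon as `N ≥ 2` and `ε < 1`.

For `N = 1` that absorption fails: `log (1/ε)` can be arbitrarily small, so a bound with a prefactor
above one is useless as `ε → 1`. Bernoulli and spherical columns are then unit vectors almost
surely. A Gaussian column needs an anti-concentration estimate: `∑ xᵢ²` lies within `nδ` of `n` with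
probability at least a constant times `nδ²` while `nδ²` is bounded (`gaussian_sq_near_mean_ge`). The
failure probability is then at most `1 - s/B ≤ exp (-s/B)` with `s = nδ²`, with no prefactor.

The spherical model reduces to the Gaussian one: a uniform direction is a normalized Gaussian vector
(`map_normalize_gaussian_eq_uniformSphere`), and normalizing columns costs a factor 4 in the
isometry constant (`isoConst_normalize_le`). -/

/-! ### Exponential moments of squares and Bernstein's inequality -/

theorem integrable_exp_sq_div_four_gaussianReal :
    Integrable (fun x : ℝ => Real.exp (x ^ 2 / 4)) (gaussianReal 0 1) := by
  rw [gaussianReal_of_var_ne_zero _ one_ne_zero,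
    integrable_withDensity_iff (by fun_prop) (by simp [gaussianPDF])]
  have h := (integrable_exp_neg_mul_sq (b := 1 / 4) (by norm_num)).const_mul
    ((Real.sqrt (2 * Real.pi * (1 : NNReal)))⁻¹)
  refine h.congr (Filter.Eventually.of_forall fun x => ?_)
  simp only [toReal_gaussianPDF, gaussianPDFReal]
  rw [mul_left_comm, ← Real.exp_add]
  congr 2
  push_cast
  ring

/-- Gaussian linearization: `exp (X²/4)` is the mean of `exp (X g / √2)` over an independent
standard Gaussian `g`. After exchanging the integrals, the sub-Gaussian bound in `X` leaves `exp
(g²/4)`, so the Gaussian value serves as the universal constant. -/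
theorem exists_integral_exp_sq_le :
    ∃ D : ℝ, 0 < D ∧ ∀ {Ω : Type*} [MeasurableSpace Ω] (μ : Measure Ω) [IsProbabilityMeasure μ]
      (X : Ω → ℝ), HasSubgaussianMGF X 1 μ →
      Integrable (fun ω => Real.exp (X ω ^ 2 / 4)) μ ∧ ∫ ω, Real.exp (X ω ^ 2 / 4) ∂μ ≤ D := by
  refine ⟨∫ x, Real.exp (x ^ 2 / 4) ∂(gaussianReal 0 1),
    integral_exp_pos integrable_exp_sq_div_four_gaussianReal, ?_⟩
  intro Ω _ μ _ X hX
  set r : ℝ := Real.sqrt (1 / 2) with hr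
  have hr2 : r ^ 2 = 1 / 2 := Real.sq_sqrt (by norm_num)
  have hXm := hX.aemeasurable
  have key : ∫⁻ ω, ENNReal.ofReal (Real.exp (X ω ^ 2 / 4)) ∂μ ≤
      ENNReal.ofReal (∫ x, Real.exp (x ^ 2 / 4) ∂(gaussianReal 0 1)) := by
    have h1 : ∀ ω, ENNReal.ofReal (Real.exp (X ω ^ 2 / 4)) =
        ∫⁻ g, ENNReal.ofReal (Real.exp (r * X ω * g)) ∂(gaussianReal 0 1) := by
      intro ω
      rw [← ofReal_integral_eq_lintegral_ofReal (integrable_exp_mul_gaussianReal _)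
        (Filter.Eventually.of_forall fun _ => (Real.exp_pos _).le)]
      have := congrFun (mgf_fun_id_gaussianReal (μ := 0) (v := 1)) (r * X ω)
      simp only [mgf] at this
      rw [this]
      congr 2
      push_cast
      rw [mul_pow, hr2]; ring
    simp_rw [h1]
    rw [lintegral_lintegral_swap]
    · rw [ofReal_integral_eq_lintegral_ofReal integrable_exp_sq_div_four_gaussianReal
        (Filter.Eventually.of_forall fun _ => (Real.exp_pos _).le)]
      refine lintegral_mono fun g => ?_
      have h2 : ∀ ω, r * X ω * g = (r * g) * X ω := fun ω => by ring
      simp_rw [h2]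
      rw [← ofReal_integral_eq_lintegral_ofReal (hX.integrable_exp_mul _)
        (Filter.Eventually.of_forall fun _ => (Real.exp_pos _).le)]
      refine ENNReal.ofReal_le_ofReal ((hX.mgf_le (r * g)).trans ?_)
      rw [Real.exp_le_exp, mul_pow, hr2]
      push_cast
      linarith
    · have h3 : AEMeasurable (fun p : Ω × ℝ => X p.1) (μ.prod (gaussianReal 0 1)) :=
        hXm.comp_quasiMeasurePreserving Measure.quasiMeasurePreserving_fst
      simp only [Function.uncurry_def]
      fun_prop
  have hm : AEStronglyMeasurable (fun ω => Real.exp (X ω ^ 2 / 4)) μ := by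
    apply AEMeasurable.aestronglyMeasurable
    fun_prop
  have hint : Integrable (fun ω => Real.exp (X ω ^ 2 / 4)) μ := by
    refine ⟨hm, ?_⟩
    rw [hasFiniteIntegral_iff_ofReal (Filter.Eventually.of_forall fun _ => (Real.exp_pos _).le)]
    exact key.trans_lt ENNReal.ofReal_lt_top
  refine ⟨hint, ?_⟩
  rw [← ofReal_integral_eq_lintegral_ofReal hint
    (Filter.Eventually.of_forall fun _ => (Real.exp_pos _).le)] at key
  exact (ENNReal.ofReal_le_ofReal_iff (integral_nonneg fun _ => (Real.exp_pos _).le)).1 key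

/-- The linear term is kept exact so that it vanishes on integrating a centred variable. -/
theorem exp_le_one_add_add_sq_mul_exp_abs (u : ℝ) :
    Real.exp u ≤ 1 + u + u ^ 2 * Real.exp |u| := by
  have h1 : 1 ≤ Real.exp |u| := Real.one_le_exp (abs_nonneg u)
  rcases le_total |u| 1 with h | h
  · have := (abs_le.1 (Real.abs_exp_sub_one_sub_id_le h)).2
    nlinarith [sq_nonneg u]
  · have h2 : 1 ≤ u ^ 2 := by rw [← sq_abs]; nlinarith
    rcases le_total 0 u with h0 | h0
    · rw [abs_of_nonneg h0]
      nlinarith [Real.exp_pos u]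
    · have h3 : Real.exp u ≤ 1 := Real.exp_le_one_iff.2 h0
      rw [abs_of_nonpos h0] at h h1 ⊢
      nlinarith

/-- With `v = |x² - 1| ≤ x² + 1`, the polynomial and exponential factors of the remainder each cost
`exp (v/8)`. Their product is at most `exp (1/4) * exp (x²/4)`, and `256 = 128 * 2`. -/
theorem exp_mul_sq_sub_one_le {s : ℝ} (hs : |s| ≤ 1 / 8) (x : ℝ) :
    Real.exp (s * (x ^ 2 - 1)) ≤ 1 + s * (x ^ 2 - 1) + 256 * s ^ 2 * Real.exp (x ^ 2 / 4) := by
  refine (exp_le_one_add_add_sq_mul_exp_abs _).trans ?_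
  set v : ℝ := |x ^ 2 - 1| with hv
  have hv0 : 0 ≤ v := abs_nonneg _
  have hvx : v ≤ x ^ 2 + 1 := by
    rw [hv, abs_le]; constructor <;> nlinarith [sq_nonneg x]
  have h1 : |s * (x ^ 2 - 1)| ≤ v / 8 := by
    rw [abs_mul]; nlinarith
  have h2 : (x ^ 2 - 1) ^ 2 ≤ 128 * Real.exp (v / 8) := by
    have := Real.quadratic_le_exp_of_nonneg (x := v / 8) (by positivity)
    rw [← sq_abs]; nlinarith
  have h3 : Real.exp (1 / 4) ≤ 2 := by
    have := Real.exp_bound_div_one_sub_of_interval (x := 1 / 4) (by norm_num) (by norm_num)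
    norm_num at this ⊢
    linarith
  have h4 : Real.exp (v / 8) * Real.exp (v / 8) ≤ 2 * Real.exp (x ^ 2 / 4) := by
    rw [← Real.exp_add]
    calc Real.exp (v / 8 + v / 8) ≤ Real.exp (1 / 4 + x ^ 2 / 4) := by
          apply Real.exp_le_exp.2; linarith
      _ = Real.exp (1 / 4) * Real.exp (x ^ 2 / 4) := Real.exp_add _ _
      _ ≤ _ := by gcongr
  have h5 : (s * (x ^ 2 - 1)) ^ 2 * Real.exp |s * (x ^ 2 - 1)| ≤
      256 * s ^ 2 * Real.exp (x ^ 2 / 4) := by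
    calc (s * (x ^ 2 - 1)) ^ 2 * Real.exp |s * (x ^ 2 - 1)|
        ≤ (s ^ 2 * (128 * Real.exp (v / 8))) * Real.exp (v / 8) := by
          rw [mul_pow]; gcongr
      _ = 128 * s ^ 2 * (Real.exp (v / 8) * Real.exp (v / 8)) := by ring
      _ ≤ 128 * s ^ 2 * (2 * Real.exp (x ^ 2 / 4)) := by gcongr
      _ = _ := by ring
  linarith

theorem exists_mgf_sq_sub_one_le :
    ∃ K : ℝ, 4 ≤ K ∧ ∀ {Ω : Type*} [MeasurableSpace Ω] (μ : Measure Ω) [IsProbabilityMeasure μ]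
      (X : Ω → ℝ), HasSubgaussianMGF X 1 μ → ∫ ω, X ω ^ 2 ∂μ = 1 → ∀ s : ℝ, |s| ≤ 1 / 8 →
      Integrable (fun ω => Real.exp (s * (X ω ^ 2 - 1))) μ ∧
        mgf (fun ω => X ω ^ 2 - 1) μ s ≤ Real.exp (K * s ^ 2) := by
  obtain ⟨D, hD, h⟩ := exists_integral_exp_sq_le
  refine ⟨max 4 (256 * D), le_max_left _ _, ?_⟩
  intro Ω _ μ _ X hX h2 s hs
  obtain ⟨hi, hle⟩ := h μ X hX
  have hXm := hX.aemeasurable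
  have hsq : Integrable (fun ω => X ω ^ 2) μ := (hX.memLp 2).integrable_sq
  have hlin : Integrable (fun ω => 1 + s * (X ω ^ 2 - 1)) μ :=
    (integrable_const _).add ((hsq.sub (integrable_const _)).const_mul s)
  have hb := hlin.add (hi.const_mul (256 * s ^ 2))
  have hint : Integrable (fun ω => Real.exp (s * (X ω ^ 2 - 1))) μ := by
    refine hb.mono' (AEMeasurable.aestronglyMeasurable (by fun_prop))
      (Filter.Eventually.of_forall fun ω => ?_)
    rw [Real.norm_of_nonneg (Real.exp_pos _).le]
    exact exp_mul_sq_sub_one_le hs (X ω)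
  refine ⟨hint, ?_⟩
  calc mgf (fun ω => X ω ^ 2 - 1) μ s
      ≤ ∫ ω, ((1 + s * (X ω ^ 2 - 1)) + 256 * s ^ 2 * Real.exp (X ω ^ 2 / 4)) ∂μ :=
        integral_mono hint hb fun ω => exp_mul_sq_sub_one_le hs (X ω)
    _ = 1 + 256 * s ^ 2 * ∫ ω, Real.exp (X ω ^ 2 / 4) ∂μ := by
        rw [integral_add hlin (hi.const_mul _), integral_const_mul]
        have h0 : ∫ ω, (1 + s * (X ω ^ 2 - 1)) ∂μ = 1 := by
          have hsub : Integrable (fun ω => X ω ^ 2 - 1) μ := hsq.sub (integrable_const _)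
          rw [integral_add (integrable_const _) (hsub.const_mul s), integral_const_mul,
            integral_sub hsq (integrable_const _), h2]
          simp
        rw [h0]
    _ ≤ 1 + 256 * s ^ 2 * D := by gcongr
    _ ≤ 1 + max 4 (256 * D) * s ^ 2 := by
        nlinarith [le_max_right 4 (256 * D), sq_nonneg s]
    _ ≤ _ := by linarith [Real.add_one_le_exp (max 4 (256 * D) * s ^ 2)]

/-- Bernstein's inequality for sums of squares of independent sub-Gaussian variables. -/
theorem exists_sum_sq_tail :
    ∃ c : ℝ, 0 < c ∧ ∀ {Ω : Type*} [MeasurableSpace Ω] (μ : Measure Ω) [IsProbabilityMeasure μ]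
      (n : ℕ) (Y : Fin n → Ω → ℝ), iIndepFun Y μ → (∀ i, Measurable (Y i)) →
      (∀ i, HasSubgaussianMGF (Y i) 1 μ) →
      (∀ i, ∫ ω, Y i ω ^ 2 ∂μ = 1) → ∀ t : ℝ, 0 < t → t ≤ 1 →
      μ.real {ω | n * t ≤ |∑ i, Y i ω ^ 2 - n|} ≤ 2 * Real.exp (-(c * n * t ^ 2)) := by
  obtain ⟨K, hK, h⟩ := exists_mgf_sq_sub_one_le
  refine ⟨1 / (4 * K), by positivity, ?_⟩
  intro Ω _ μ _ n Y hind hYm hsub hsq t ht ht1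
  set Z : Fin n → Ω → ℝ := fun i ω => Y i ω ^ 2 - 1 with hZ
  have hZm : ∀ i, Measurable (Z i) := fun i => by
    have := hYm i
    fun_prop
  have hZind : iIndepFun Z μ := hind.comp (fun _ x => x ^ 2 - 1) (fun _ => by fun_prop)
  have hsum : ∀ ω, (∑ i, Z i) ω = ∑ i, Y i ω ^ 2 - n := fun ω => by
    simp [hZ, Finset.sum_apply]
  have hmgf : ∀ s : ℝ, |s| ≤ 1 / 8 → mgf (∑ i, Z i) μ s ≤ Real.exp (n * (K * s ^ 2)) := by
    intro s hs
    rw [hZind.mgf_sum hZm]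
    calc ∏ i, mgf (Z i) μ s ≤ ∏ _i : Fin n, Real.exp (K * s ^ 2) :=
          Finset.prod_le_prod (fun i _ => mgf_nonneg) fun i _ => (h μ (Y i) (hsub i) (hsq i) s hs).2
      _ = _ := by simp [← Real.exp_nat_mul]
  have hint : ∀ s : ℝ, |s| ≤ 1 / 8 → Integrable (fun ω => Real.exp (s * (∑ i, Z i) ω)) μ := by
    intro s hs
    exact hZind.integrable_exp_mul_sum hZm (fun i _ => (h μ (Y i) (hsub i) (hsq i) s hs).1)
  have hK0 : 0 < K := by linarith
  -- The minimizer of `-s t + K s²`; `4 ≤ K` and `t ≤ 1` keep it in the range where the moment bound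
  -- holds.
  set s : ℝ := t / (2 * K) with hsdef
  have hs0 : 0 ≤ s := by positivity
  have hs8 : s ≤ 1 / 8 := by
    rw [hsdef, div_le_iff₀ (by positivity)]; nlinarith
  have hsabs : |s| ≤ 1 / 8 := by rwa [abs_of_nonneg hs0]
  have hsabs' : |-s| ≤ 1 / 8 := by rwa [abs_neg]
  have hexp : -s * (n * t) + n * (K * s ^ 2) = -(1 / (4 * K) * n * t ^ 2) := by
    rw [hsdef]; field_simp; ring
  have hup : μ.real {ω | n * t ≤ (∑ i, Z i) ω} ≤ Real.exp (-(1 / (4 * K) * n * t ^ 2)) := by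
    refine (measure_ge_le_exp_mul_mgf _ hs0 (hint s hsabs)).trans ?_
    rw [← hexp, Real.exp_add]
    gcongr
    exact hmgf s hsabs
  have hlo : μ.real {ω | (∑ i, Z i) ω ≤ -(n * t)} ≤ Real.exp (-(1 / (4 * K) * n * t ^ 2)) := by
    refine (measure_le_le_exp_mul_mgf _ (neg_nonpos.2 hs0) (hint (-s) hsabs')).trans ?_
    rw [← hexp, Real.exp_add]
    have := hmgf (-s) hsabs'
    rw [neg_sq] at this
    rw [show - -s * -(n * t) = -s * (n * t) by ring]
    gcongr
  have hsubset : {ω | n * t ≤ |∑ i, Y i ω ^ 2 - n|} ⊆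
      {ω | n * t ≤ (∑ i, Z i) ω} ∪ {ω | (∑ i, Z i) ω ≤ -(n * t)} := by
    intro ω hω
    simp only [Set.mem_union, Set.mem_ofPred_eq, hsum] at hω ⊢
    rcases le_abs.1 hω with h | h
    · exact Or.inl h
    · exact Or.inr (by linarith)
  calc _ ≤ _ := measureReal_mono hsubset
    _ ≤ _ := measureReal_union_le _ _
    _ ≤ _ := by linarith

/-! ### Nets on the sphere and test vectors for the spectral norm -/

/-- A `1/2`-separated subset of the sphere of largest cardinality is a net, since an uncovered point
could be added to it. -/
theorem exists_half_net_sphere (E : Type*) [NormedAddCommGroup E] [NormedSpace ℝ E]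
    [FiniteDimensional ℝ E] :
    ∃ G : Finset E, G.card ≤ 5 ^ Module.finrank ℝ E ∧ (∀ y ∈ G, ‖y‖ = 1) ∧
      ∀ x : E, ‖x‖ = 1 → ∃ y ∈ G, ‖x - y‖ ≤ 1 / 2 := by
  classical
  let P : Finset E → Prop := fun s =>
    (∀ y ∈ s, ‖y‖ = 1) ∧ ∀ c ∈ s, ∀ d ∈ s, c ≠ d → 1 / 2 ≤ ‖c - d‖
  have hcard : ∀ s, P s → s.card ≤ 5 ^ Module.finrank ℝ E := by
    intro s hs
    -- Doubling turns the set into a 1-separated subset of the ball of radius 2, the setting of the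
    -- packing bound `5 ^ d`.
    have hinj : Function.Injective fun y : E => (2 : ℝ) • y :=
      smul_right_injective E two_ne_zero
    rw [← Finset.card_image_of_injective s hinj]
    apply Besicovitch.card_le_of_separated
    · intro c hc
      obtain ⟨y, hy, rfl⟩ := Finset.mem_image.1 hc
      simp [norm_smul, hs.1 y hy]
    · intro c hc d hd hcd
      obtain ⟨y, hy, rfl⟩ := Finset.mem_image.1 hc
      obtain ⟨z, hz, rfl⟩ := Finset.mem_image.1 hd
      have := hs.2 y hy z hz (fun h => hcd (by rw [h]))
      simp only [← smul_sub, norm_smul, Real.norm_ofNat]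
      linarith
  have hne : {m : ℕ | ∃ s, P s ∧ s.card = m}.Nonempty := ⟨0, ∅, by simp [P], rfl⟩
  have hbdd : BddAbove {m : ℕ | ∃ s, P s ∧ s.card = m} :=
    ⟨5 ^ Module.finrank ℝ E, by rintro m ⟨s, hs, rfl⟩; exact hcard s hs⟩
  obtain ⟨G, hG, hGm⟩ := Nat.sSup_mem hne hbdd
  refine ⟨G, hcard G hG, hG.1, fun x hx => ?_⟩
  by_contra! hcon
  have hxG : x ∉ G := fun h => by
    have := hcon x h
    norm_num at this
  have hP : P (insert x G) := by
    refine ⟨?_, ?_⟩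
    · intro y hy
      rcases Finset.mem_insert.1 hy with rfl | hy
      exacts [hx, hG.1 y hy]
    · intro c hc d hd hcd
      rcases Finset.mem_insert.1 hc with rfl | hc' <;>
        rcases Finset.mem_insert.1 hd with rfl | hd'
      · exact absurd rfl hcd
      · exact (hcon d hd').le
      · rw [norm_sub_rev]; exact (hcon c hc').le
      · exact hG.2 c hc' d hd' hcd
  have hle := le_csSup hbdd ⟨insert x G, hP, rfl⟩
  rw [← hGm, Finset.card_insert_of_notMem hxG] at hle
  omega

/-- Each use of the net loses a factor 2: approximating the direction of `T u` gives `‖T u‖ ≤ t + ‖T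
u‖ / 2` on the net, and approximating the argument gives `‖T‖ ≤ 2t + ‖T‖ / 2`. -/
theorem opNorm_le_of_half_net {E : Type*} [NormedAddCommGroup E] [InnerProductSpace ℝ E]
    {G : Finset E}
    (hG : ∀ x : E, ‖x‖ = 1 → ∃ y ∈ G, ‖x - y‖ ≤ 1 / 2) (T : E →L[ℝ] E) {t : ℝ} (ht : 0 ≤ t)
    (h : ∀ u ∈ G, ∀ v ∈ G, |inner ℝ (T u) v| ≤ t) : ‖T‖ ≤ 4 * t := by
  have h1 : ∀ u ∈ G, ‖T u‖ ≤ 2 * t := by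
    intro u hu
    by_cases h0 : T u = 0
    · rw [h0, norm_zero]; positivity
    have hpos : 0 < ‖T u‖ := norm_pos_iff.2 h0
    obtain ⟨v, hv, hle⟩ := hG (‖T u‖⁻¹ • T u) (by
      rw [norm_smul, norm_inv, norm_norm, inv_mul_cancel₀ hpos.ne'])
    have e1 : inner ℝ (T u) (‖T u‖⁻¹ • T u) = ‖T u‖ := by
      rw [real_inner_smul_right, real_inner_self_eq_norm_sq]
      field_simp
    have e2 := real_inner_le_norm (T u) (‖T u‖⁻¹ • T u - v)
    rw [inner_sub_right, e1] at e2
    have e3 := (abs_le.1 (h u hu v hv)).2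
    nlinarith
  have h2 : ‖T‖ ≤ 2 * t + ‖T‖ / 2 := by
    refine T.opNorm_le_of_unit_norm (by positivity) fun x hx => ?_
    obtain ⟨y, hy, hle⟩ := hG x hx
    calc ‖T x‖ = ‖T y + T (x - y)‖ := by rw [← map_add, add_sub_cancel]
      _ ≤ ‖T y‖ + ‖T (x - y)‖ := norm_add_le _ _
      _ ≤ 2 * t + ‖T‖ * (1 / 2) := by
          gcongr
          · exact h1 y hy
          · exact (T.le_opNorm _).trans (by gcongr)
      _ = _ := by ring
  linarith

theorem inner_toEuclideanCLM_gram_sub_one {n : ℕ} {ι : Type*} [Fintype ι] [DecidableEq ι]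
    (B : Matrix (Fin n) ι ℝ) (u v : EuclideanSpace ℝ ι) :
    inner ℝ (Matrix.toEuclideanCLM (n := ι) (𝕜 := ℝ) (Bᵀ * B - 1) u) v =
      (B *ᵥ v.ofLp) ⬝ᵥ (B *ᵥ u.ofLp) - v.ofLp ⬝ᵥ u.ofLp := by
  rw [EuclideanSpace.inner_eq_star_dotProduct, Matrix.ofLp_toEuclideanCLM, Matrix.sub_mulVec,
    Matrix.one_mulVec, star_trivial, dotProduct_sub, ← Matrix.mulVec_mulVec,
    Matrix.dotProduct_mulVec, Matrix.vecMul_transpose]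

/-- The deviation of a Gram matrix from the identity in spectral norm is controlled by testing
the quadratic form on a finite set of vectors. -/
theorem exists_test_vectors_specNorm (ι : Type*) [Fintype ι] [DecidableEq ι] :
    ∃ F : Finset (ι → ℝ), F.card ≤ 2 * 25 ^ Fintype.card ι ∧
      ∀ (n : ℕ) (B : Matrix (Fin n) ι ℝ) (t : ℝ), 0 ≤ t →
        (∀ z ∈ F, |(B *ᵥ z) ⬝ᵥ (B *ᵥ z) - z ⬝ᵥ z| ≤ t * (z ⬝ᵥ z)) →
        specNorm (Bᵀ * B - 1) ≤ 4 * t := by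
  classical
  obtain ⟨G, hcard, hG1, hG⟩ := exists_half_net_sphere (EuclideanSpace ℝ ι)
  -- Polarization: four times the bilinear form at `(u, v)` is the quadratic form at `u + v` minus
  -- that at `u - v`. Since `‖u + v‖² + ‖u - v‖² = 4`, the relative error `t` passes to the bilinear
  -- form unchanged.
  refine ⟨(G ×ˢ G).image (fun p => p.1.ofLp + p.2.ofLp) ∪
    (G ×ˢ G).image (fun p => p.1.ofLp - p.2.ofLp), ?_, ?_⟩
  · rw [finrank_euclideanSpace] at hcard
    have h25 : G.card * G.card ≤ 25 ^ Fintype.card ι := by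
      calc G.card * G.card ≤ 5 ^ Fintype.card ι * 5 ^ Fintype.card ι := by gcongr
        _ = _ := by rw [← mul_pow]; norm_num
    have h1 := Finset.card_image_le (s := G ×ˢ G) (f := fun p => p.1.ofLp + p.2.ofLp)
    have h2 := Finset.card_image_le (s := G ×ˢ G) (f := fun p => p.1.ofLp - p.2.ofLp)
    rw [Finset.card_product] at h1 h2
    refine (Finset.card_union_le _ _).trans ?_
    omega
  · intro n B t ht hF
    refine opNorm_le_of_half_net hG _ ht fun u hu v hv => ?_
    rw [inner_toEuclideanCLM_gram_sub_one]
    have hp := hF (u.ofLp + v.ofLp) (Finset.mem_union_left _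
      (Finset.mem_image.2 ⟨(u, v), Finset.mem_product.2 ⟨hu, hv⟩, rfl⟩))
    have hm := hF (u.ofLp - v.ofLp) (Finset.mem_union_right _
      (Finset.mem_image.2 ⟨(u, v), Finset.mem_product.2 ⟨hu, hv⟩, rfl⟩))
    have hnorm : ∀ y ∈ G, y.ofLp ⬝ᵥ y.ofLp = 1 := by
      intro y hy
      have := hG1 y hy
      have h2 : ‖y‖ ^ 2 = 1 := by rw [this]; norm_num
      rw [EuclideanSpace.real_norm_sq_eq] at h2
      rw [← h2, dotProduct]
      exact Finset.sum_congr rfl fun i _ => by ring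
    have hu1 := hnorm u hu
    have hv1 := hnorm v hv
    simp only [Matrix.mulVec_add, Matrix.mulVec_sub, add_dotProduct, dotProduct_add,
      sub_dotProduct, dotProduct_sub, hu1, hv1, dotProduct_comm u.ofLp v.ofLp,
      dotProduct_comm (B *ᵥ u.ofLp) (B *ᵥ v.ofLp)] at hp hm
    rw [abs_le] at hp hm ⊢
    constructor <;> linarith

/-! ### Sub-Gaussian arrays and the tail for a fixed set of columns -/

/-- A centered probability law on `ℝ` with unit variance and sub-Gaussian constant `1`. -/
structure IsNormalizedSubgaussian (ν : Measure ℝ) : Prop where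
  subgaussian : HasSubgaussianMGF id 1 ν
  integral_eq_zero : ∫ x, x ∂ν = 0
  integral_sq_eq_one : ∫ x, x ^ 2 ∂ν = 1

namespace IsNormalizedSubgaussian

variable {ν : Measure ℝ} [IsProbabilityMeasure ν] {κ : Type*} [Fintype κ]

theorem hasSubgaussianMGF_eval (hν : IsNormalizedSubgaussian ν) (j : κ) :
    HasSubgaussianMGF (fun r : κ → ℝ => r j) 1 (Measure.pi fun _ => ν) := by
  have h := measurePreserving_eval (fun _ : κ => ν) j
  have := (HasSubgaussianMGF.id_map_iff (c := 1) h.aemeasurable).1 (by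
    rw [h.map_eq]; exact hν.subgaussian)
  exact this

theorem hasSubgaussianMGF_linear (hν : IsNormalizedSubgaussian ν) (z : κ → ℝ)
    (hz : ∑ j, z j ^ 2 = 1) :
    HasSubgaussianMGF (fun r : κ → ℝ => ∑ j, r j * z j) 1 (Measure.pi fun _ => ν) := by
  have hind : iIndepFun (fun (j : κ) (r : κ → ℝ) => r j * z j) (Measure.pi fun _ => ν) :=
    iIndepFun_pi (X := fun j x => x * z j) fun j => by fun_prop
  have h := HasSubgaussianMGF.sum_of_iIndepFun hind (s := Finset.univ)
    (c := fun j => NNReal.mk (z j ^ 2) (sq_nonneg _) * 1) fun j _ => by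
      have h1 := (hν.hasSubgaussianMGF_eval j).const_mul (z j)
      simp only [mul_comm (z j)] at h1
      exact h1
  convert h using 1
  ext
  rw [NNReal.coe_one, NNReal.coe_sum, ← hz]
  refine Finset.sum_congr rfl fun j _ => ?_
  rw [NNReal.coe_mul, NNReal.coe_one, mul_one]
  rfl

theorem integral_linear_sq (hν : IsNormalizedSubgaussian ν) (z : κ → ℝ)
    (hz : ∑ j, z j ^ 2 = 1) :
    ∫ r : κ → ℝ, (∑ j, r j * z j) ^ 2 ∂(Measure.pi fun _ => ν) = 1 := by
  have hsub := hν.hasSubgaussianMGF_linear z hz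
  have hev : ∀ j : κ, ∫ r : κ → ℝ, r j ∂(Measure.pi fun _ => ν) = 0 := fun j => by
    rw [← hν.integral_eq_zero]
    exact integral_comp_eval (μ := fun _ : κ => ν) (f := fun x : ℝ => x)
      aestronglyMeasurable_id
  have hev2 : ∀ j : κ, ∫ r : κ → ℝ, r j ^ 2 ∂(Measure.pi fun _ => ν) = 1 := fun j => by
    rw [← hν.integral_sq_eq_one]
    exact integral_comp_eval (μ := fun _ : κ => ν) (f := fun x : ℝ => x ^ 2)
      (by fun_prop)
  have hmem : ∀ j : κ, MemLp (fun r : κ → ℝ => r j * z j) 2 (Measure.pi fun _ => ν) := fun j =>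
    ((hν.hasSubgaussianMGF_eval j).memLp 2).mul_const (z j)
  have hind : iIndepFun (fun (j : κ) (r : κ → ℝ) => r j * z j) (Measure.pi fun _ => ν) :=
    iIndepFun_pi (X := fun j x => x * z j) fun j => by fun_prop
  have hmean : ∫ r : κ → ℝ, ∑ j, r j * z j ∂(Measure.pi fun _ => ν) = 0 := by
    rw [integral_finsetSum _ fun j _ => (hmem j).integrable (by norm_num)]
    simp [integral_mul_const, hev]
  have hvar := IndepFun.variance_sum (s := Finset.univ) (fun j _ => hmem j)
    (fun i _ j _ hij => hind.indepFun hij)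
  have e1 : (∑ j, fun r : κ → ℝ => r j * z j) = fun r : κ → ℝ => ∑ j, r j * z j := by
    ext r; simp
  rw [e1, variance_of_integral_eq_zero (Measurable.aemeasurable (by fun_prop)) hmean] at hvar
  rw [hvar, ← hz]
  refine Finset.sum_congr rfl fun j _ => ?_
  rw [variance_of_integral_eq_zero (Measurable.aemeasurable (by fun_prop)) (by rw [integral_mul_const, hev, zero_mul])]
  simp_rw [mul_pow]
  rw [integral_mul_const, hev2, one_mul]

end IsNormalizedSubgaussian

/-- The law of an `n × κ` array of independent variables with common law `ν`. -/
noncomputable def arrayLaw (ν : Measure ℝ) (n : ℕ) (κ : Type*) [Fintype κ] :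
    Measure (Fin n → κ → ℝ) :=
  Measure.pi fun _ => Measure.pi fun _ => ν

instance (ν : Measure ℝ) [IsProbabilityMeasure ν] (n : ℕ) (κ : Type*) [Fintype κ] :
    IsProbabilityMeasure (arrayLaw ν n κ) := by
  unfold arrayLaw; infer_instance

theorem exists_quadratic_tail :
    ∃ c : ℝ, 0 < c ∧ ∀ (ν : Measure ℝ) [IsProbabilityMeasure ν], IsNormalizedSubgaussian ν →
      ∀ (n : ℕ) {κ : Type} [Fintype κ] (z : κ → ℝ) (t : ℝ), 0 < t → t ≤ 1 →
      (arrayLaw ν n κ).real {x | n * t * (∑ j, z j ^ 2) <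
        |∑ i, (∑ j, x i j * z j) ^ 2 - n * ∑ j, z j ^ 2|} ≤ 2 * Real.exp (-(c * n * t ^ 2)) := by
  obtain ⟨c, hc, h⟩ := exists_sum_sq_tail
  refine ⟨c, hc, ?_⟩
  intro ν _ hν n κ _ z t ht ht1
  set w := ∑ j, z j ^ 2 with hw
  have hw0 : 0 ≤ w := Finset.sum_nonneg fun j _ => sq_nonneg _
  rcases hw0.eq_or_lt with hw0 | hw0
  -- For `z = 0` the event is empty because its inequality is strict; otherwise homogeneity reduces
  -- to a unit vector.
  · have hz : ∀ j, z j = 0 := fun j => by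
      have := (Finset.sum_eq_zero_iff_of_nonneg (fun j _ => sq_nonneg (z j))).1 hw0.symm j
        (Finset.mem_univ j)
      exact pow_eq_zero_iff two_ne_zero |>.1 this
    simp only [← hw0, hz]
    simp
    positivity
  · set z' : κ → ℝ := fun j => z j / Real.sqrt w with hz'
    have hs : 0 < Real.sqrt w := Real.sqrt_pos.2 hw0
    have hs2 : Real.sqrt w ^ 2 = w := Real.sq_sqrt hw0.le
    have hz1 : ∑ j, z' j ^ 2 = 1 := by
      simp only [hz', div_pow, hs2]
      rw [← Finset.sum_div, ← hw, div_self hw0.ne']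
    have key := h (arrayLaw ν n κ) n (fun i x => ∑ j, x i j * z' j)
      (iIndepFun_pi (X := fun _ (r : κ → ℝ) => ∑ j, r j * z' j) fun i =>
        Measurable.aemeasurable (by fun_prop))
      (fun i => by fun_prop)
      (fun i => by
        have hmp := measurePreserving_eval (fun _ : Fin n => (Measure.pi fun _ : κ => ν)) i
        have h1 := hν.hasSubgaussianMGF_linear z' hz1
        rw [← hmp.map_eq] at h1
        exact HasSubgaussianMGF.of_map (X := fun r : κ → ℝ => ∑ j, r j * z' j)
          hmp.aemeasurable h1)
      (fun i => by
        rw [← hν.integral_linear_sq z' hz1]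
        exact integral_comp_eval (μ := fun _ : Fin n => (Measure.pi fun _ : κ => ν))
          (f := fun r : κ → ℝ => (∑ j, r j * z' j) ^ 2)
          (Measurable.aestronglyMeasurable (by fun_prop)))
      t ht ht1
    refine le_trans (measureReal_mono fun x hx => ?_) key
    simp only [Set.mem_ofPred_eq] at hx ⊢
    have e1 : ∑ i, (∑ j, x i j * z' j) ^ 2 - n = (∑ i, (∑ j, x i j * z j) ^ 2 - n * w) / w := by
      have : ∀ i, (∑ j, x i j * z' j) ^ 2 = (∑ j, x i j * z j) ^ 2 / w := fun i => by
        rw [← hs2, ← div_pow, Finset.sum_div]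
        simp only [hz', mul_div_assoc]
      simp only [this]
      rw [← Finset.sum_div, sub_div, mul_div_cancel_right₀ _ hw0.ne']
    rw [e1, abs_div, abs_of_pos hw0, le_div_iff₀ hw0]
    exact hx.le

theorem exists_isoConst_tail :
    ∃ c : ℝ, 0 < c ∧ ∀ (ν : Measure ℝ) [IsProbabilityMeasure ν], IsNormalizedSubgaussian ν →
      ∀ (n N : ℕ) (T : Finset (Fin N)) (δ : ℝ), 0 < n → 0 < δ → δ ≤ 1 →
      (arrayLaw ν n (Fin N)).real
        {x | δ < isoConst ((1 / Real.sqrt n) • (Matrix.of x : Matrix (Fin n) (Fin N) ℝ)) T} ≤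
        4 * 25 ^ T.card * Real.exp (-(c * n * δ ^ 2)) := by
  classical
  obtain ⟨c, hc, h⟩ := exists_quadratic_tail
  -- The quadratic form is tested at level `δ / 4` to offset the factor 4 lost to the net, hence
  -- `(1/4)² = 1/16`.
  refine ⟨c / 16, by positivity, ?_⟩
  intro ν _ hν n N T δ hn hδ hδ1
  obtain ⟨F, hF, htest⟩ := exists_test_vectors_specNorm T
  have hn0 : (0 : ℝ) < n := by exact_mod_cast hn
  -- Extending test vectors by zero lets the quadratic tail be applied to the full array, without
  -- passing to the law of a subarray.
  set ext : (T → ℝ) → Fin N → ℝ := fun z j => if h : j ∈ T then z ⟨j, h⟩ else 0 with hext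
  have hsumT : ∀ (f : Fin N → ℝ → ℝ) (z : T → ℝ), (∀ j, f j 0 = 0) →
      ∑ j, f j (ext z j) = ∑ j : T, f j (z j) := by
    intro f z hf
    rw [← Finset.sum_subset (Finset.subset_univ T), ← Finset.sum_coe_sort]
    · refine Finset.sum_congr rfl fun j _ => ?_
      simp [hext, j.2]
    · intro j _ hj
      simp [hext, hj, hf]
  set bad : (T → ℝ) → Set (Fin n → Fin N → ℝ) := fun z => {x | n * (δ / 4) * (∑ j, ext z j ^ 2) <
        |∑ i, (∑ j, x i j * ext z j) ^ 2 - n * ∑ j, ext z j ^ 2|}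
  have hsub : {x | δ < isoConst ((1 / Real.sqrt n) • (Matrix.of x : Matrix (Fin n) (Fin N) ℝ)) T}
      ⊆ ⋃ z ∈ F, bad z := by
    intro x hx
    by_contra hcon
    simp only [Set.mem_iUnion, not_exists] at hcon
    have hle := htest n
      (colSubmatrix ((1 / Real.sqrt n) • (Matrix.of x : Matrix (Fin n) (Fin N) ℝ)) T) (δ / 4)
      (by positivity) fun z hz => by
        have h1 := hcon z hz
        simp only [bad, Set.mem_ofPred_eq, not_lt] at h1
        have e1 : ∑ j, ext z j ^ 2 = z ⬝ᵥ z := by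
          rw [hsumT (fun _ y => y ^ 2) z (by simp), dotProduct]
          exact Finset.sum_congr rfl fun j _ => by ring
        set M := colSubmatrix ((1 / Real.sqrt n) • (Matrix.of x : Matrix (Fin n) (Fin N) ℝ)) T
          with hM
        have e2 : ∑ i, (∑ j, x i j * ext z j) ^ 2 = n * ((M *ᵥ z) ⬝ᵥ (M *ᵥ z)) := by
          rw [dotProduct, Finset.mul_sum]
          refine Finset.sum_congr rfl fun i _ => ?_
          rw [hsumT (fun j y => x i j * y) z (by simp)]
          have : (M *ᵥ z) i = 1 / Real.sqrt n * ∑ j : T, x i j * z j := by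
            rw [Finset.mul_sum, Matrix.mulVec, dotProduct]
            refine Finset.sum_congr rfl fun j _ => ?_
            simp [hM, colSubmatrix, mul_assoc]
          rw [this]
          have hs : Real.sqrt n ^ 2 = n := Real.sq_sqrt hn0.le
          have hs0 : 0 < Real.sqrt n := Real.sqrt_pos.2 hn0
          field_simp
          rw [hs]
        rw [e1, e2, ← mul_sub, abs_mul, abs_of_pos hn0, mul_assoc] at h1
        exact le_of_mul_le_mul_left h1 hn0
    have : isoConst ((1 / Real.sqrt n) • (Matrix.of x : Matrix (Fin n) (Fin N) ℝ)) T ≤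
      4 * (δ / 4) := hle
    have hx' : δ < isoConst ((1 / Real.sqrt n) • (Matrix.of x : Matrix (Fin n) (Fin N) ℝ)) T := hx
    linarith
  calc _ ≤ (arrayLaw ν n (Fin N)).real (⋃ z ∈ F, bad z) := measureReal_mono hsub (measure_ne_top _ _)
    _ ≤ ∑ z ∈ F, (arrayLaw ν n (Fin N)).real (bad z) := measureReal_biUnion_finset_le _ _
    _ ≤ ∑ _z ∈ F, 2 * Real.exp (-(c * n * (δ / 4) ^ 2)) :=
        Finset.sum_le_sum fun z _ => h ν hν n (ext z) (δ / 4) (by positivity) (by linarith)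
    _ = F.card * (2 * Real.exp (-(c * n * (δ / 4) ^ 2))) := by simp
    _ ≤ (2 * 25 ^ T.card) * (2 * Real.exp (-(c * n * (δ / 4) ^ 2))) := by
        gcongr
        rw [Fintype.card_coe] at hF
        exact_mod_cast hF
    _ = 4 * 25 ^ T.card * Real.exp (-(c / 16 * n * δ ^ 2)) := by
        rw [show c * n * (δ / 4) ^ 2 = c / 16 * n * δ ^ 2 by ring]; ring

/-! ### Union bound over the added column -/

theorem deltaStar_le_of_forall {n N : ℕ} {A : Matrix (Fin n) (Fin N) ℝ} {S : Finset (Fin N)}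
    {δ : ℝ} (hδ : 0 ≤ δ) (h : ∀ ℓ ∉ S, isoConst A (insert ℓ S) ≤ δ) : deltaStar A S ≤ δ :=
  Real.iSup_le (fun ℓ => h ℓ.1 ℓ.2) hδ

/-- The union bound over the `N - k` possible augmentations of `S`. -/
theorem measureReal_deltaStar_gt_le {Ω : Type*} [MeasurableSpace Ω] (μ : Measure Ω)
    [IsProbabilityMeasure μ] {n N : ℕ} (A : Ω → Matrix (Fin n) (Fin N) ℝ) (S : Finset (Fin N))
    {δ b : ℝ} (hδ : 0 ≤ δ)
    (h : ∀ ℓ ∉ S, μ.real {ω | δ < isoConst (A ω) (insert ℓ S)} ≤ b) (hb : 0 ≤ b) :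
    μ.real {ω | δ < deltaStar (A ω) S} ≤ N * b := by
  classical
  calc μ.real {ω | δ < deltaStar (A ω) S}
      ≤ μ.real (⋃ ℓ ∈ Sᶜ, {ω | δ < isoConst (A ω) (insert ℓ S)}) := by
        refine measureReal_mono (fun ω hω => ?_) (measure_ne_top _ _)
        by_contra hcon
        simp only [Set.mem_iUnion, not_exists, Finset.mem_compl, Set.mem_ofPred_eq, not_lt] at hcon
        exact absurd (deltaStar_le_of_forall hδ hcon) (not_le.2 hω)
    _ ≤ ∑ ℓ ∈ Sᶜ, μ.real {ω | δ < isoConst (A ω) (insert ℓ S)} :=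
        measureReal_biUnion_finset_le _ _
    _ ≤ ∑ _ℓ ∈ Sᶜ, b := Finset.sum_le_sum fun ℓ hℓ => h ℓ (Finset.mem_compl.1 hℓ)
    _ = (Sᶜ.card : ℝ) * b := by simp
    _ ≤ N * b := by
        gcongr
        exact_mod_cast (Finset.card_le_univ _).trans (by simp)

/-! ### The two entry laws and the joint law of the entries -/

theorem isNormalizedSubgaussian_gaussianReal : IsNormalizedSubgaussian (gaussianReal 0 1) where
  subgaussian :=
    { integrable_exp_mul := fun t => integrable_exp_mul_gaussianReal t
      mgf_le := fun t => by rw [mgf_id_gaussianReal]; simp }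
  integral_eq_zero := integral_id_gaussianReal
  integral_sq_eq_one := by
    rw [← variance_of_integral_eq_zero (X := fun x : ℝ => x) aemeasurable_id
      integral_id_gaussianReal, variance_fun_id_gaussianReal]
    simp

instance : IsProbabilityMeasure signMeasure := by
  constructor
  simp [signMeasure, ENNReal.inv_two_add_inv_two]

theorem integral_signMeasure (f : ℝ → ℝ) : ∫ x, f x ∂signMeasure = (f 1 + f (-1)) / 2 := by
  have h : ∀ a : ℝ, Integrable f ((2⁻¹ : ℝ≥0∞) • Measure.dirac a) := fun a =>
    (integrable_dirac (by simp)).smul_measure (by simp)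
  rw [signMeasure, integral_add_measure (h 1) (h (-1))]
  simp
  ring

theorem ae_signMeasure_sq : ∀ᵐ x ∂signMeasure, x ^ 2 = 1 := by
  have hm : MeasurableSet {x : ℝ | x ^ 2 = 1} := by
    apply measurableSet_eq_fun <;> fun_prop
  simp only [signMeasure, ae_add_measure_iff]
  constructor <;> refine Measure.ae_smul_measure ?_ _ <;> rw [ae_dirac_iff hm] <;> norm_num

theorem isNormalizedSubgaussian_signMeasure : IsNormalizedSubgaussian signMeasure where
  subgaussian := by
    -- Hoeffding's lemma on `[-1, 1]` gives exactly the constant `((1 - (-1)) / 2)² = 1`.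
    have h := hasSubgaussianMGF_of_mem_Icc_of_integral_eq_zero (μ := signMeasure) (X := id)
      (a := -1) (b := 1) aemeasurable_id (ae_signMeasure_sq.mono fun x hx => by
        simp only [id, Set.mem_Icc]
        constructor <;> nlinarith) (by simp [integral_signMeasure])
    convert h using 1
    ext
    norm_num
  integral_eq_zero := by rw [integral_signMeasure]; norm_num
  integral_sq_eq_one := by rw [integral_signMeasure]; norm_num

theorem iIndepFun_arrayLaw (ν : Measure ℝ) [IsProbabilityMeasure ν] (n N : ℕ) :
    iIndepFun (fun (p : Fin n × Fin N) (x : Fin n → Fin N → ℝ) => x p.1 p.2)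
      (arrayLaw ν n (Fin N)) := by
  refine iIndepFun_uncurry' (X := fun i j (x : Fin n → Fin N → ℝ) => x i j) (by fun_prop) ?_ ?_
  · exact iIndepFun_pi (X := fun _ r => r) fun i => aemeasurable_id
  · intro i
    have hmp := measurePreserving_eval (fun _ : Fin n => (Measure.pi fun _ : Fin N => ν)) i
    have h1 : iIndepFun (fun (j : Fin N) (r : Fin N → ℝ) => r j) (Measure.pi fun _ => ν) :=
      iIndepFun_pi (X := fun _ x => x) fun i => aemeasurable_id
    rw [iIndepFun_iff_map_fun_eq_pi_map (fun j => Measurable.aemeasurable (by fun_prop))]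
      at h1 ⊢
    rw [← hmp.map_eq, Measure.map_map (by fun_prop) hmp.measurable] at h1
    simp only [Measure.map_map (measurable_pi_apply _) hmp.measurable] at h1
    exact h1

theorem hasLaw_arrayLaw_eval (ν : Measure ℝ) [IsProbabilityMeasure ν] (n N : ℕ) (i : Fin n)
    (j : Fin N) : HasLaw (fun x : Fin n → Fin N → ℝ => x i j) ν (arrayLaw ν n (Fin N)) := by
  have h1 := measurePreserving_eval (fun _ : Fin n => (Measure.pi fun _ : Fin N => ν)) i
  have h2 := measurePreserving_eval (fun _ : Fin N => ν) j
  exact (h2.comp h1).hasLaw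

/-- The joint law of an array of independent identically distributed entries. -/
theorem hasLaw_array {Ω : Type*} [MeasurableSpace Ω] {μ : Measure Ω} [IsProbabilityMeasure μ]
    {ν : Measure ℝ} [IsProbabilityMeasure ν] {n N : ℕ} {Φ : Ω → Fin n → Fin N → ℝ}
    (hlaw : ∀ i j, HasLaw (fun ω => Φ ω i j) ν μ)
    (hind : iIndepFun (fun (p : Fin n × Fin N) (ω : Ω) => Φ ω p.1 p.2) μ) :
    HasLaw Φ (arrayLaw ν n (Fin N)) μ := by
  have hm : ∀ i j, AEMeasurable (fun ω => Φ ω i j) μ := fun i j => (hlaw i j).aemeasurable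
  have hΦ : AEMeasurable Φ μ := aemeasurable_pi_lambda _ fun i => aemeasurable_pi_lambda _ (hm i)
  refine ⟨hΦ, ?_⟩
  have h1 := (iIndepFun_iff_map_fun_eq_pi_map (f := fun (p : Fin n × Fin N) ω => Φ ω p.1 p.2)
    fun p => hm p.1 p.2).1 hind
  have h2 := (iIndepFun_iff_map_fun_eq_pi_map fun p =>
    Measurable.aemeasurable (by fun_prop)).1 (iIndepFun_arrayLaw ν n N)
  simp only [(hlaw _ _).map_eq] at h1
  simp only [(hasLaw_arrayLaw_eval ν n N _ _).map_eq] at h2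
  have h3 := h1.trans h2.symm
  have hcurry : Measurable fun (y : Fin n × Fin N → ℝ) (i : Fin n) (j : Fin N) => y (i, j) := by
    fun_prop
  have h4 := congrArg (Measure.map fun (y : Fin n × Fin N → ℝ) i j => y (i, j)) h3
  rw [AEMeasurable.map_map_of_aemeasurable hcurry.aemeasurable
    (aemeasurable_pi_lambda _ fun p => hm p.1 p.2), Measure.map_map hcurry (by fun_prop)] at h4
  have h5 : ((fun (y : Fin n × Fin N → ℝ) (i : Fin n) (j : Fin N) => y (i, j)) ∘
    fun (x : Fin n → Fin N → ℝ) (p : Fin n × Fin N) => x p.1 p.2) = id := rfl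
  rw [h5, Measure.map_id] at h4
  exact h4

/-- Only this inequality is needed to transfer tails, and it holds for arbitrary `s`, so the bad
events need not be shown measurable. -/
theorem measureReal_preimage_le_of_hasLaw {Ω 𝓧 : Type*} [MeasurableSpace Ω] [MeasurableSpace 𝓧]
    {μ : Measure Ω} {ν : Measure 𝓧} [IsProbabilityMeasure ν] {X : Ω → 𝓧}
    (hX : HasLaw X ν μ) (s : Set 𝓧) : μ.real (X ⁻¹' s) ≤ ν.real s := by
  refine ENNReal.toReal_mono (measure_ne_top _ _) ?_
  rw [← hX.map_eq]
  exact Measure.le_map_apply hX.aemeasurable s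

theorem one_sub_le_measureReal_deltaStar_le {Ω : Type*} [MeasurableSpace Ω] (μ : Measure Ω)
    [IsProbabilityMeasure μ] {n N : ℕ} (A : Ω → Matrix (Fin n) (Fin N) ℝ) (S : Finset (Fin N))
    {δ b : ℝ} (h : μ.real {ω | δ < deltaStar (A ω) S} ≤ b) :
    1 - b ≤ μ.real {ω | deltaStar (A ω) S ≤ δ} := by
  have h1 : μ.real Set.univ ≤
      μ.real {ω | deltaStar (A ω) S ≤ δ} + μ.real {ω | δ < deltaStar (A ω) S} := by
    refine le_trans (measureReal_mono (fun ω _ => ?_) (measure_ne_top _ _))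
      (measureReal_union_le _ _)
    exact le_or_gt (deltaStar (A ω) S) δ
  rw [probReal_univ] at h1
  linarith

/-! ### Choice of the sample-size constant -/

/-- Half of the exponent `2mM` cancels `25 ^ k`, because `m * log (1/δ) ≥ log 25` uniformly in `δ ≤
δ₀`; the other half supplies `(ε/N)^8`. What remains is `100 ε (ε/N)^7 ≤ (100/128) ε`, where `N ≥ 2`
is essential. -/
theorem exists_const_union_bound_le {δ₀ c : ℝ} (hδ₀ : 0 < δ₀) (hδ₀1 : δ₀ < 1) (hc : 0 < c) :
    ∃ C : ℝ, 0 < C ∧ ∀ (n N k : ℕ) (δ ε : ℝ), 2 ≤ N → 0 < δ → δ ≤ δ₀ → 0 < ε → ε < 1 →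
      C * (δ ^ 2)⁻¹ * max ((k : ℝ) * Real.log (1 / δ)) (Real.log ((N : ℝ) / ε)) ≤ (n : ℝ) →
      0 < n ∧ N * (4 * 25 ^ (k + 1) * Real.exp (-(c * n * δ ^ 2))) ≤ ε := by
  have hl0 : 0 < Real.log (1 / δ₀) := Real.log_pos (by rw [lt_div_iff₀ hδ₀]; linarith)
  set m : ℝ := max 8 (Real.log 25 / Real.log (1 / δ₀)) with hm
  have hm8 : 8 ≤ m := le_max_left _ _
  refine ⟨2 * m / c, by positivity, ?_⟩
  intro n N k δ ε hN hδ hδδ₀ hε hε1 hn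
  have hN2 : (2 : ℝ) ≤ N := by exact_mod_cast hN
  set L := Real.log ((N : ℝ) / ε) with hL
  have hNε : 2 < (N : ℝ) / ε := by rw [lt_div_iff₀ hε]; nlinarith
  have hL0 : 0 < L := Real.log_pos (by linarith)
  have hlog : Real.log (1 / δ₀) ≤ Real.log (1 / δ) := by
    apply Real.log_le_log (by positivity)
    gcongr
  set M := max ((k : ℝ) * Real.log (1 / δ)) L with hM
  have hM1 : (k : ℝ) * Real.log (1 / δ) ≤ M := le_max_left _ _
  have hM2 : L ≤ M := le_max_right _ _
  have hδ2 : 0 < δ ^ 2 := by positivity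
  have hn' : 2 * m * M ≤ c * n * δ ^ 2 := by
    have : 2 * m / c * (δ ^ 2)⁻¹ * M = 2 * m * M / (c * δ ^ 2) := by field_simp
    rw [this, div_le_iff₀ (by positivity)] at hn
    linarith
  have hn0 : 0 < n := by
    rw [Nat.pos_iff_ne_zero]
    rintro rfl
    have : 0 < 2 * m * M := by positivity
    simp at hn'
    linarith
  refine ⟨hn0, ?_⟩
  have hmlog : Real.log 25 ≤ m * Real.log (1 / δ) := by
    have h1 : Real.log 25 / Real.log (1 / δ₀) ≤ m := le_max_right _ _
    rw [div_le_iff₀ hl0] at h1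
    nlinarith
  have hexp : (k : ℝ) * Real.log 25 + 8 * L ≤ c * n * δ ^ 2 := by
    have h1 : (k : ℝ) * Real.log 25 ≤ m * (k * Real.log (1 / δ)) := by
      calc (k : ℝ) * Real.log 25 ≤ k * (m * Real.log (1 / δ)) := by gcongr
        _ = _ := by ring
    nlinarith
  have e1 : Real.exp (-(c * n * δ ^ 2)) ≤ (25 ^ k)⁻¹ * (ε / N) ^ 8 := by
    calc Real.exp (-(c * n * δ ^ 2)) ≤ Real.exp (-((k : ℝ) * Real.log 25 + 8 * L)) := by
          apply Real.exp_le_exp.2; linarith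
      _ = _ := by
        rw [neg_add, Real.exp_add, Real.exp_neg, Real.exp_nat_mul, Real.exp_log (by norm_num),
          Real.exp_neg, show (8 : ℝ) * L = ((8 : ℕ) : ℝ) * L by norm_num, Real.exp_nat_mul, hL,
          Real.exp_log (by positivity), ← inv_pow, ← inv_pow, inv_div]
  have hr : ε / N ≤ 1 / 2 := by
    rw [div_le_div_iff₀ (by positivity) (by norm_num)]; nlinarith
  have hr7 : (ε / N) ^ 7 ≤ (1 / 2) ^ 7 := by gcongr
  calc N * (4 * 25 ^ (k + 1) * Real.exp (-(c * n * δ ^ 2)))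
      ≤ N * (4 * 25 ^ (k + 1) * ((25 ^ k)⁻¹ * (ε / N) ^ 8)) := by gcongr
    _ = 100 * ε * (ε / N) ^ 7 := by
        rw [pow_succ (25 : ℝ) k, pow_succ (ε / N : ℝ) 7]
        field_simp
        norm_num
    _ ≤ 100 * ε * (1 / 2) ^ 7 := by gcongr
    _ ≤ ε := by norm_num; linarith

/-! ### Matrices with a single column -/

theorem specNorm_le_of_unique {ι : Type*} [Fintype ι] [DecidableEq ι] [Unique ι]
    (M : Matrix ι ι ℝ) : specNorm M ≤ |M default default| := by
  refine ContinuousLinearMap.opNorm_le_bound _ (abs_nonneg _) fun x => ?_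
  have : Matrix.toEuclideanCLM (n := ι) (𝕜 := ℝ) M x = M default default • x := by
    ext i
    rw [Unique.eq_default i, Matrix.ofLp_toEuclideanCLM]
    simp [Matrix.mulVec, dotProduct]
  rw [this, norm_smul, Real.norm_eq_abs]

theorem isoConst_singleton_le {n N : ℕ} (A : Matrix (Fin n) (Fin N) ℝ) (ℓ : Fin N) :
    isoConst A {ℓ} ≤ |∑ i, A i ℓ ^ 2 - 1| := by
  let _ : Unique ({ℓ} : Finset (Fin N)) :=
    { default := ⟨ℓ, Finset.mem_singleton_self ℓ⟩
      uniq := fun j => Subtype.ext (Finset.mem_singleton.1 j.2) }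
  refine (specNorm_le_of_unique _).trans_eq ?_
  congr 1
  rw [Matrix.sub_apply, Matrix.one_apply_eq, Matrix.mul_apply]
  congr 1
  exact Finset.sum_congr rfl fun i _ => by rw [pow_two]; rfl

theorem deltaStar_le_of_card_one {n : ℕ} (A : Matrix (Fin n) (Fin 1) ℝ) (S : Finset (Fin 1))
    {δ : ℝ} (hδ : 0 ≤ δ) (h : |∑ i, A i 0 ^ 2 - 1| ≤ δ) : deltaStar A S ≤ δ := by
  refine deltaStar_le_of_forall hδ fun ℓ _ => ?_
  have e : insert ℓ S = {(0 : Fin 1)} := by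
    ext j
    simp [Subsingleton.elim j 0, Subsingleton.elim ℓ 0]
  rw [e]
  exact (isoConst_singleton_le A 0).trans h

/-- Signs square to one, so the scaled column is almost surely a unit vector. -/
theorem IsBernoulliMatrix.deltaStar_tail_card_one {Ω : Type*} [MeasurableSpace Ω] {μ : Measure Ω}
    [IsProbabilityMeasure μ] {n : ℕ} {Φ : Ω → Matrix (Fin n) (Fin 1) ℝ}
    (hΦ : IsBernoulliMatrix μ Φ) (hn : 0 < n) (S : Finset (Fin 1)) {δ : ℝ} (hδ : 0 ≤ δ) :
    μ.real {ω | δ < deltaStar ((1 / Real.sqrt (n : ℝ)) • Φ ω) S} = 0 := by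
  have hm : Measurable fun x : ℝ => x ^ 2 = 1 := by
    apply measurableSet_setOfPred.1
    apply measurableSet_eq_fun <;> fun_prop
  have hae : ∀ᵐ ω ∂μ, ∀ i, Φ ω i 0 ^ 2 = 1 := by
    rw [ae_all_iff]
    exact fun i => ((hΦ.1 i 0).ae_iff hm).2 ae_signMeasure_sq
  rw [measureReal_eq_zero_iff]
  refine measure_mono_null ?_ hae
  intro ω hω hcon
  refine absurd (deltaStar_le_of_card_one _ S hδ ?_) (not_le.2 hω)
  have hn0 : (0 : ℝ) < n := by exact_mod_cast hn
  have : ∑ i, ((1 / Real.sqrt (n : ℝ)) • Φ ω) i 0 ^ 2 = 1 := by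
    have hcon' : ∀ i, Φ ω i 0 ^ 2 = 1 := hcon
    simp [Matrix.smul_apply, mul_pow, hcon', Real.sq_sqrt hn0.le, hn0.ne']
  rw [this]
  simpa using hδ

/-- The tail bound for `δ*(S)` for an array of normalized sub-Gaussian entries. -/
theorem exists_deltaStar_tail :
    ∃ c : ℝ, 0 < c ∧ ∀ (ν : Measure ℝ) [IsProbabilityMeasure ν], IsNormalizedSubgaussian ν →
      ∀ (n N : ℕ) (S : Finset (Fin N)) (δ : ℝ), 0 < n → 0 < δ → δ ≤ 1 →
      (arrayLaw ν n (Fin N)).real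
        {x | δ < deltaStar ((1 / Real.sqrt n) • (Matrix.of x : Matrix (Fin n) (Fin N) ℝ)) S} ≤
        N * (4 * 25 ^ (S.card + 1) * Real.exp (-(c * n * δ ^ 2))) := by
  obtain ⟨c, hc, h⟩ := exists_isoConst_tail
  refine ⟨c, hc, fun ν _ hν n N S δ hn hδ hδ1 => ?_⟩
  refine measureReal_deltaStar_gt_le _ _ S hδ.le (fun ℓ hℓ => ?_) (by positivity)
  rw [← Finset.card_insert_of_notMem hℓ]
  exact h ν hν n N _ δ hn hδ hδ1

/-! ### Chi-square anti-concentration by rescaling -/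

theorem lintegral_pi_prod_eq_prod_lintegral {n : ℕ} {α : Type*} [MeasurableSpace α]
    (μ : Measure α) [SigmaFinite μ] {f : Fin n → α → ℝ≥0∞} (hf : ∀ i, Measurable (f i)) :
    ∫⁻ x, ∏ i, f i (x i) ∂(Measure.pi fun _ => μ) = ∏ i, ∫⁻ y, f i y ∂μ := by
  induction n with
  | zero => simp
  | succ n ih =>
    have hp : Measurable fun x : Fin (n + 1) → α => ∏ i, f i (x i) := by fun_prop
    have hmp := (measurePreserving_piFinSuccAbove (fun _ : Fin (n + 1) => μ) 0).symm
    rw [← hmp.lintegral_comp hp, Fin.prod_univ_succ, ← ih fun i => hf i.succ]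
    have hq : Measurable fun x : Fin n → α => ∏ i : Fin n, f i.succ (x i) := by fun_prop
    refine Eq.trans (lintegral_congr fun x => ?_)
      (lintegral_prod_mul (hf 0).aemeasurable hq.aemeasurable)
    rw [Fin.prod_univ_succ]
    rfl

theorem pi_withDensity_eq {n : ℕ} {α : Type*} [MeasurableSpace α] (μ : Measure α)
    [SigmaFinite μ] {f : α → ℝ≥0∞} (hf : Measurable f) [SigmaFinite (μ.withDensity f)] :
    Measure.pi (fun _ : Fin n => μ.withDensity f) =
      (Measure.pi fun _ => μ).withDensity fun x => ∏ i, f (x i) := by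
  refine Measure.pi_eq fun s hs => ?_
  rw [withDensity_apply _ (MeasurableSet.univ_pi hs), ← lintegral_indicator
    (MeasurableSet.univ_pi hs)]
  have h := lintegral_pi_prod_eq_prod_lintegral μ (f := fun i => (s i).indicator f)
    fun i => hf.indicator (hs i)
  simp only [lintegral_indicator (hs _)] at h
  simp only [withDensity_apply _ (hs _), ← h]
  congr 1
  ext x
  classical
  by_cases hx : x ∈ Set.univ.pi s
  · rw [Set.indicator_of_mem hx]
    exact Finset.prod_congr rfl fun i _ => (Set.indicator_of_mem (hx i trivial) _).symm
  · rw [Set.indicator_of_notMem hx]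
    simp only [Set.mem_univ_pi, not_forall] at hx
    obtain ⟨i, hi⟩ := hx
    exact (Finset.prod_eq_zero (Finset.mem_univ i) (Set.indicator_of_notMem hi _)).symm

/-- A rescaled standard Gaussian has an explicit density with respect to the standard one. -/
theorem gaussianReal_map_exp_mul (a : ℝ) :
    (gaussianReal 0 1).map (fun x => Real.exp (-(a / 2)) * x) =
      (gaussianReal 0 1).withDensity
        fun x => ENNReal.ofReal (Real.exp (a / 2 - (Real.exp a - 1) * x ^ 2 / 2)) := by
  rw [gaussianReal_map_const_mul]
  have hv : NNReal.mk (Real.exp (-(a / 2)) ^ 2) (sq_nonneg _) * 1 ≠ 0 := by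
    rw [mul_one]
    refine ne_of_gt ?_
    rw [← NNReal.coe_pos]
    exact pow_pos (Real.exp_pos _) 2
  rw [mul_zero]
  change gaussianReal 0 (NNReal.mk (Real.exp (-(a / 2)) ^ 2) (sq_nonneg _) * 1) = _
  rw [gaussianReal_of_var_ne_zero _ hv, gaussianReal_of_var_ne_zero _ one_ne_zero,
    ← withDensity_mul _ (measurable_gaussianPDF _ _) (by fun_prop)]
  congr 1
  ext x
  rw [Pi.mul_apply, gaussianPDF, gaussianPDF, ← ENNReal.ofReal_mul (gaussianPDFReal_nonneg _ _ _)]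
  congr 1
  have hve : ((NNReal.mk (Real.exp (-(a / 2)) ^ 2) (sq_nonneg _) * 1 : NNReal) : ℝ) =
      Real.exp (-a) := by
    rw [mul_one]
    change Real.exp (-(a / 2)) ^ 2 = _
    rw [← Real.exp_nat_mul]; congr 1; push_cast; ring
  have hsqrt : Real.sqrt (Real.exp (-a)) = Real.exp (-(a / 2)) := by
    rw [show Real.exp (-a) = Real.exp (-(a / 2)) ^ 2 by
      rw [← Real.exp_nat_mul]; congr 1; push_cast; ring]
    exact Real.sqrt_sq (Real.exp_pos _).le
  rw [gaussianPDFReal, gaussianPDFReal, hve, NNReal.coe_one, Real.sqrt_mul (by positivity), hsqrt,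
    mul_inv, ← Real.exp_neg, neg_neg, mul_one, mul_assoc, mul_assoc, ← Real.exp_add,
    ← Real.exp_add]
  congr 2
  rw [Real.exp_neg]
  field_simp
  ring

/-- With `Q = ∑ xᵢ²`, scaling by `exp (-a/2)` gives the Gaussian measure the relative density `exp
(na/2 - (exp a - 1) Q / 2)`. The hypothesis puts `I` above `n` when `a > 0` and below `n` when `a <
0`, so the density on `I` is at most its value at `Q = n`, which never exceeds one. -/
theorem gaussian_sq_rescale_le (n : ℕ) (a : ℝ) {I : Set ℝ} (hI : MeasurableSet I)
    (h : ∀ q ∈ I, (Real.exp a - 1) * n ≤ (Real.exp a - 1) * q) :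
    (Measure.pi fun _ : Fin n => gaussianReal 0 1).real
        {x | Real.exp (-a) * ∑ i, x i ^ 2 ∈ I} ≤
      Real.exp (n / 2 * (a + 1 - Real.exp a)) *
        (Measure.pi fun _ : Fin n => gaussianReal 0 1).real {x | ∑ i, x i ^ 2 ∈ I} := by
  set γ := Measure.pi fun _ : Fin n => gaussianReal 0 1 with hγ
  set f : ℝ → ℝ≥0∞ :=
    fun x => ENNReal.ofReal (Real.exp (a / 2 - (Real.exp a - 1) * x ^ 2 / 2)) with hf
  have hfm : Measurable f := by fun_prop
  have hE : MeasurableSet {x : Fin n → ℝ | ∑ i, x i ^ 2 ∈ I} :=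
    hI.preimage (f := fun x : Fin n → ℝ => ∑ i, x i ^ 2) (by fun_prop)
  have hmap : γ.map (fun x i => Real.exp (-(a / 2)) * x i) =
      γ.withDensity fun x => ∏ i, f (x i) := by
    rw [hγ, Measure.pi_map_pi (f := fun _ y => Real.exp (-(a / 2)) * y) fun i => by fun_prop]
    simp only [gaussianReal_map_exp_mul]
    have : IsProbabilityMeasure ((gaussianReal 0 1).withDensity f) := by
      rw [← gaussianReal_map_exp_mul]
      exact Measure.isProbabilityMeasure_map (by fun_prop)
    exact pi_withDensity_eq (gaussianReal 0 1) hfm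
  have h1 : γ {x | Real.exp (-a) * ∑ i, x i ^ 2 ∈ I} =
      γ.map (fun x i => Real.exp (-(a / 2)) * x i) {x | ∑ i, x i ^ 2 ∈ I} := by
    rw [Measure.map_apply (by fun_prop) hE]
    congr 1
    ext x
    simp only [Set.mem_preimage, Set.mem_ofPred_eq, mul_pow, ← Finset.mul_sum]
    rw [← Real.exp_nat_mul]
    norm_num
    rw [show -(2 * (a / 2)) = -a by ring]
  have h2 : ∀ x ∈ {x : Fin n → ℝ | ∑ i, x i ^ 2 ∈ I},
      ∏ i, f (x i) ≤ ENNReal.ofReal (Real.exp (n / 2 * (a + 1 - Real.exp a))) := by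
    intro x hx
    rw [hf, ← ENNReal.ofReal_prod_of_nonneg fun i _ => (Real.exp_pos _).le, ← Real.exp_sum]
    refine ENNReal.ofReal_le_ofReal (Real.exp_le_exp.2 ?_)
    have := h _ hx
    have e : ∑ i, (Real.exp a - 1) * x i ^ 2 / 2 = (Real.exp a - 1) * (∑ i, x i ^ 2) / 2 := by
      rw [Finset.mul_sum, Finset.sum_div]
    rw [Finset.sum_sub_distrib, e]
    simp only [Finset.sum_const, Finset.card_univ, Fintype.card_fin, nsmul_eq_mul]
    linarith
  rw [measureReal_def, measureReal_def, 
    ← ENNReal.toReal_ofReal (Real.exp_pos (n / 2 * (a + 1 - Real.exp a))).le, ← ENNReal.toReal_mul]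
  refine ENNReal.toReal_mono (ENNReal.mul_ne_top ENNReal.ofReal_ne_top (measure_ne_top _ _)) ?_
  rw [h1, hmap, withDensity_apply _ hE, ← setLIntegral_const]
  exact setLIntegral_mono measurable_const h2

theorem exp_neg_ge_of_le_four {h : ℝ} (h4 : h ≤ 4) :
    1 - h + 3 / 16 * h ^ 2 ≤ Real.exp (-h) := by
  have h1 : 1 - h / 4 ≤ Real.exp (-(h / 4)) := by
    linarith [Real.add_one_le_exp (-(h / 4))]
  have h2 : (1 - h / 4) ^ 4 ≤ Real.exp (-(h / 4)) ^ 4 :=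
    pow_le_pow_left₀ (by linarith) h1 4
  rw [← Real.exp_nat_mul] at h2
  have h3 : ((4 : ℕ) : ℝ) * -(h / 4) = -h := by push_cast; ring
  rw [h3] at h2
  refine le_trans ?_ h2
  have h5 : 0 ≤ (h / 4) ^ 2 * ((1 - h / 4) * (3 - h / 4)) := by
    have : 0 ≤ 1 - h / 4 := by linarith
    have : 0 ≤ 3 - h / 4 := by linarith
    positivity
  nlinarith

theorem exp_neg_three_halves_le : Real.exp (-(3 / 2)) ≤ 1 / 4 := by
  rw [Real.exp_neg, ← one_div]
  apply one_div_le_one_div_of_le (by norm_num)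
  have := Real.sum_le_exp_of_nonneg (x := 3 / 2) (by norm_num) 5
  norm_num [Finset.sum_range_succ, Nat.factorial] at this
  linarith

/-- Chi-square anti-concentration: the logarithmic scale around the mean is covered by
`2 * m` slices, each of which is at most as likely as a central one. -/
theorem one_le_mul_gaussian_sq_near_mean {n : ℕ} (hn : 0 < n) {δ : ℝ} (hδ : 0 < δ) (m : ℕ)
    (hm : 4 / Real.sqrt n ≤ m * Real.log (1 + δ)) :
    1 ≤ 4 * m * (Measure.pi fun _ : Fin n => gaussianReal 0 1).real
        {x | |∑ i, x i ^ 2 - n| ≤ n * δ} := by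
  set γ := Measure.pi fun _ : Fin n => gaussianReal 0 1 with hγ
  set Q : (Fin n → ℝ) → ℝ := fun x => ∑ i, x i ^ 2 with hQ
  have hQ0 : ∀ x, 0 ≤ Q x := fun x => Finset.sum_nonneg fun i _ => sq_nonneg _
  set a := Real.log (1 + δ) with ha
  have ha0 : 0 < a := Real.log_pos (by linarith)
  have hea : Real.exp a = 1 + δ := Real.exp_log (by linarith)
  have hn1 : (1 : ℝ) ≤ n := by exact_mod_cast hn
  have hn0 : (0 : ℝ) < n := by linarith
  set p := γ.real {x | |Q x - n| ≤ n * δ} with hp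
  -- Then `n h² = 16`, so both tails beyond `n * exp (±h)` have mass at most `exp (-3/2) ≤ 1/4`. The
  -- binding one is the lower: `(n/2) * (3/16) * h² = 3/2`.
  set h : ℝ := 4 / Real.sqrt n with hh
  have hs0 : 0 < Real.sqrt n := Real.sqrt_pos.2 hn0
  have hs1 : 1 ≤ Real.sqrt n := Real.one_le_sqrt.2 hn1
  have hh0 : 0 ≤ h := by positivity
  have hh4 : h ≤ 4 := by rw [hh, div_le_iff₀ hs0]; linarith
  have hh2 : (n : ℝ) * h ^ 2 = 16 := by
    rw [hh, div_pow, Real.sq_sqrt hn0.le]; field_simp; norm_num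
  have hup : ∀ b : ℝ, 0 ≤ b → ∀ I : Set ℝ, MeasurableSet I → (∀ q ∈ I, (n : ℝ) ≤ q) →
      γ.real {x | Real.exp (-b) * Q x ∈ I} ≤
        Real.exp (n / 2 * (b + 1 - Real.exp b)) * γ.real {x | Q x ∈ I} := by
    intro b hb I hI hIn
    refine gaussian_sq_rescale_le n b hI fun q hq => ?_
    have := Real.one_le_exp hb
    exact mul_le_mul_of_nonneg_left (hIn q hq) (by linarith)
  have hdown : ∀ b : ℝ, 0 ≤ b → ∀ I : Set ℝ, MeasurableSet I → (∀ q ∈ I, q ≤ (n : ℝ)) →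
      γ.real {x | Real.exp b * Q x ∈ I} ≤
        Real.exp (n / 2 * (-b + 1 - Real.exp (-b))) * γ.real {x | Q x ∈ I} := by
    intro b hb I hI hIn
    have h1 := gaussian_sq_rescale_le n (-b) hI fun q hq => by
      have : Real.exp (-b) ≤ 1 := Real.exp_le_one_iff.2 (by linarith)
      exact mul_le_mul_of_nonpos_left (hIn q hq) (by linarith)
    rwa [neg_neg] at h1
  have hcoef : ∀ b : ℝ, Real.exp (n / 2 * (b + 1 - Real.exp b)) ≤ 1 := by
    intro b
    rw [Real.exp_le_one_iff]
    have := Real.add_one_le_exp b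
    have : 0 ≤ (n : ℝ) / 2 * (Real.exp b - (b + 1)) := mul_nonneg (by positivity) (by linarith)
    linarith
  have hsliceUp : ∀ j : ℕ, γ.real {x | Real.exp (-(j * a)) * Q x ∈ Set.Ico (n : ℝ) (n * (1 + δ))}
      ≤ p := by
    intro j
    refine (hup (j * a) (by positivity) _ measurableSet_Ico fun q hq => hq.1).trans ?_
    refine (mul_le_of_le_one_left measureReal_nonneg (hcoef _)).trans ?_
    refine measureReal_mono (fun x hx => ?_) (measure_ne_top _ _)
    have h1 : (n : ℝ) ≤ Q x := hx.1
    have h2 : Q x < n * (1 + δ) := hx.2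
    change |Q x - n| ≤ n * δ
    rw [abs_le]; constructor <;> nlinarith
  have hsliceDown : ∀ j : ℕ, γ.real {x | Real.exp (j * a) * Q x ∈ Set.Ico ((n : ℝ) / (1 + δ)) n}
      ≤ p := by
    intro j
    refine (hdown (j * a) (by positivity) _ measurableSet_Ico fun q hq => hq.2.le).trans ?_
    refine (mul_le_of_le_one_left measureReal_nonneg (hcoef _)).trans ?_
    refine measureReal_mono (fun x hx => ?_) (measure_ne_top _ _)
    have h1 : (n : ℝ) / (1 + δ) ≤ Q x := hx.1
    have h2 : Q x < n := hx.2
    rw [div_le_iff₀ (by linarith)] at h1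
    change |Q x - n| ≤ n * δ
    rw [abs_le]; constructor <;> nlinarith
  have htailUp : γ.real {x | Real.exp (-h) * Q x ∈ Set.Ici (n : ℝ)} ≤ 1 / 4 := by
    refine (hup h hh0 _ measurableSet_Ici fun q hq => hq).trans ?_
    refine (mul_le_of_le_one_right (Real.exp_pos _).le measureReal_le_one).trans ?_
    refine le_trans (Real.exp_le_exp.2 ?_) exp_neg_three_halves_le
    have := Real.quadratic_le_exp_of_nonneg hh0
    nlinarith
  have htailDown : γ.real {x | Real.exp h * Q x ∈ Set.Iic (n : ℝ)} ≤ 1 / 4 := by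
    refine (hdown h hh0 _ measurableSet_Iic fun q hq => hq).trans ?_
    refine (mul_le_of_le_one_right (Real.exp_pos _).le measureReal_le_one).trans ?_
    refine le_trans (Real.exp_le_exp.2 ?_) exp_neg_three_halves_le
    have := exp_neg_ge_of_le_four hh4
    nlinarith
  have hcoverUp : ∀ (x : Fin n → ℝ) (k : ℕ), (n : ℝ) ≤ Q x → Q x < n * Real.exp (k * a) →
      ∃ j ∈ Finset.range k, Real.exp (-(j * a)) * Q x ∈ Set.Ico (n : ℝ) (n * (1 + δ)) := by
    intro x k h1
    induction k with
    | zero => intro h2; simp at h2; linarith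
    | succ k ih =>
      intro h2
      rcases lt_or_ge (Q x) (n * Real.exp (k * a)) with h3 | h3
      · obtain ⟨j, hj, hx⟩ := ih h3
        exact ⟨j, Finset.mem_range.2 ((Finset.mem_range.1 hj).trans k.lt_succ_self), hx⟩
      · refine ⟨k, Finset.self_mem_range_succ k, ?_, ?_⟩
        · rw [Real.exp_neg, inv_mul_eq_div, le_div_iff₀ (Real.exp_pos _)]; exact h3
        · rw [Real.exp_neg, inv_mul_eq_div, div_lt_iff₀ (Real.exp_pos _)]
          push_cast at h2
          rw [add_mul, one_mul, Real.exp_add, hea] at h2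
          linarith
  have hcoverDown : ∀ (x : Fin n → ℝ) (k : ℕ), Q x < n → n ≤ Real.exp (k * a) * Q x →
      ∃ j ∈ Finset.range k, Real.exp (j * a) * Q x ∈ Set.Ico ((n : ℝ) / (1 + δ)) n := by
    intro x k h1
    induction k with
    | zero => intro h2; simp at h2; linarith
    | succ k ih =>
      intro h2
      rcases le_or_gt (n : ℝ) (Real.exp (k * a) * Q x) with h3 | h3
      · obtain ⟨j, hj, hx⟩ := ih h3
        exact ⟨j, Finset.mem_range.2 ((Finset.mem_range.1 hj).trans k.lt_succ_self), hx⟩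
      · refine ⟨k, Finset.self_mem_range_succ k, ?_, h3⟩
        rw [div_le_iff₀ (by linarith)]
        push_cast at h2
        rw [add_mul, one_mul, Real.exp_add, hea] at h2
        linarith
  -- The two tails weigh at most `1/2` together and the `2m` slices at most `p` each, so `1 ≤ 1/2 +
  -- 2mp`.
  have hcover : (Set.univ : Set (Fin n → ℝ)) ⊆
      ({x | Real.exp (-h) * Q x ∈ Set.Ici (n : ℝ)} ∪ {x | Real.exp h * Q x ∈ Set.Iic (n : ℝ)}) ∪
      ((⋃ j ∈ Finset.range m,
        {x | Real.exp (-(j * a)) * Q x ∈ Set.Ico (n : ℝ) (n * (1 + δ))}) ∪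
       (⋃ j ∈ Finset.range m,
        {x | Real.exp (j * a) * Q x ∈ Set.Ico ((n : ℝ) / (1 + δ)) n})) := by
    intro x _
    have hmono : Real.exp h ≤ Real.exp (m * a) := Real.exp_le_exp.2 hm
    rcases le_or_gt (n : ℝ) (Q x) with h1 | h1
    · rcases lt_or_ge (Q x) (n * Real.exp (m * a)) with h2 | h2
      · right; left
        obtain ⟨j, hj, hx⟩ := hcoverUp x m h1 h2
        exact Set.mem_biUnion hj hx
      · left; left
        change (n : ℝ) ≤ Real.exp (-h) * Q x
        rw [Real.exp_neg, inv_mul_eq_div, le_div_iff₀ (Real.exp_pos _)]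
        exact (mul_le_mul_of_nonneg_left hmono hn0.le).trans h2
    · rcases le_or_gt (n : ℝ) (Real.exp (m * a) * Q x) with h2 | h2
      · right; right
        obtain ⟨j, hj, hx⟩ := hcoverDown x m h1 h2
        exact Set.mem_biUnion hj hx
      · left; right
        exact (mul_le_mul_of_nonneg_right hmono (hQ0 x)).trans h2.le
  have hsum : ∀ s : ℕ → Set (Fin n → ℝ), (∀ j, γ.real (s j) ≤ p) →
      γ.real (⋃ j ∈ Finset.range m, s j) ≤ m * p := by
    intro s hs
    refine (measureReal_biUnion_finset_le _ _).trans ?_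
    refine (Finset.sum_le_sum fun j _ => hs j).trans ?_
    simp
  have h1 := measureReal_mono hcover (measure_ne_top γ _)
  rw [probReal_univ] at h1
  have h2 := h1.trans (measureReal_union_le _ _)
  have h3 := measureReal_union_le (μ := γ) {x | Real.exp (-h) * Q x ∈ Set.Ici (n : ℝ)}
    {x | Real.exp h * Q x ∈ Set.Iic (n : ℝ)}
  have h4 := measureReal_union_le (μ := γ) (⋃ j ∈ Finset.range m,
        {x | Real.exp (-(j * a)) * Q x ∈ Set.Ico (n : ℝ) (n * (1 + δ))})
       (⋃ j ∈ Finset.range m, {x | Real.exp (j * a) * Q x ∈ Set.Ico ((n : ℝ) / (1 + δ)) n})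
  have h5 := hsum _ hsliceUp
  have h6 := hsum _ hsliceDown
  linarith

/-- With `r = √n δ`, about `8/r` slices of logarithmic width at least `δ/2` suffice, so the central
probability is of order `r`. Since `r ≤ M`, this is weakened to order `r² = nδ²`, the form used
against `exp (-s/B)`. -/
theorem gaussian_sq_near_mean_ge {n : ℕ} (hn : 0 < n) {δ M : ℝ} (hδ : 0 < δ) (hδ1 : δ ≤ 1)
    (hM : 1 ≤ M) (hs : n * δ ^ 2 ≤ M) :
    n * δ ^ 2 / (4 * (8 + M) * M) ≤ (Measure.pi fun _ : Fin n => gaussianReal 0 1).real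
        {x | |∑ i, x i ^ 2 - n| ≤ n * δ} := by
  have hn0 : (0 : ℝ) < n := by exact_mod_cast hn
  set p := (Measure.pi fun _ : Fin n => gaussianReal 0 1).real
        {x | |∑ i, x i ^ 2 - n| ≤ n * δ} with hp
  have hp0 : 0 ≤ p := measureReal_nonneg
  have hlog : δ / 2 ≤ Real.log (1 + δ) := by
    refine le_trans ?_ (Real.le_log_one_add_of_nonneg hδ.le)
    rw [div_le_div_iff₀ (by norm_num) (by linarith)]
    nlinarith
  set r : ℝ := Real.sqrt n * δ with hr
  have hs0 : 0 < Real.sqrt n := Real.sqrt_pos.2 hn0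
  have hr0 : 0 < r := by positivity
  have hr2 : r ^ 2 = n * δ ^ 2 := by rw [hr, mul_pow, Real.sq_sqrt hn0.le]
  have hrM : r ≤ M := by nlinarith
  set m := ⌈8 / r⌉₊ with hm
  have hm1 : 8 / r ≤ m := Nat.le_ceil _
  have hm2 : (m : ℝ) < 8 / r + 1 := Nat.ceil_lt_add_one (by positivity)
  have key := one_le_mul_gaussian_sq_near_mean hn hδ m (by
    calc 4 / Real.sqrt n = 8 / r * (δ / 2) := by rw [hr]; field_simp; norm_num
      _ ≤ m * Real.log (1 + δ) := by gcongr)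
  have hm3 : (m : ℝ) * r ≤ 8 + M := by
    have : (8 / r + 1) * r = 8 + r := by field_simp
    nlinarith
  rw [div_le_iff₀ (by positivity), ← hr2]
  have h1 : r ≤ 4 * (8 + M) * p := by
    calc r ≤ (4 * m * p) * r := by nlinarith
      _ = 4 * (m * r) * p := by ring
      _ ≤ 4 * (8 + M) * p := by gcongr
  calc r ^ 2 = r * r := by ring
    _ ≤ (4 * (8 + M) * p) * M := by gcongr
    _ = _ := by ring

theorem hasLaw_arrayLaw_column (ν : Measure ℝ) [IsProbabilityMeasure ν] (n : ℕ) :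
    HasLaw (fun (x : Fin n → Fin 1 → ℝ) i => x i 0) (Measure.pi fun _ : Fin n => ν)
      (arrayLaw ν n (Fin 1)) :=
  (measurePreserving_pi (fun _ : Fin n => Measure.pi fun _ : Fin 1 => ν) (fun _ => ν)
    fun _ => measurePreserving_eval (fun _ : Fin 1 => ν) 0).hasLaw

/-- A single Gaussian column concentrates, including when the allowed failure probability is
close to one. -/
theorem exists_const_gaussian_column {δ₀ : ℝ} (hδ₀1 : δ₀ < 1) :
    ∃ C : ℝ, 0 < C ∧ ∀ (n : ℕ) (δ ε : ℝ), 0 < δ → δ ≤ δ₀ → 0 < ε → ε < 1 →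
      C * (δ ^ 2)⁻¹ * Real.log (1 / ε) ≤ (n : ℝ) →
      (arrayLaw (gaussianReal 0 1) n (Fin 1)).real {x | n * δ < |∑ i, x i 0 ^ 2 - n|} ≤ ε := by
  obtain ⟨c, hc, htail⟩ := exists_quadratic_tail
  -- Above this threshold for `s = nδ²`, half of the Bernstein exponent absorbs the prefactor 2;
  -- below it, the anti-concentration bound takes over.
  set M : ℝ := max 1 (2 * Real.log 2 / c) with hM
  have hM1 : 1 ≤ M := le_max_left _ _
  set C : ℝ := max (2 / c) (4 * (8 + M) * M) with hC
  have hC0 : 0 < C := lt_max_of_lt_left (by positivity)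
  refine ⟨C, hC0, ?_⟩
  intro n δ ε hδ hδδ₀ hε hε1 hn
  have hδ1 : δ ≤ 1 := by linarith
  have hL : 0 < Real.log (1 / ε) := Real.log_pos (by rw [lt_div_iff₀ hε]; linarith)
  have hn0 : 0 < n := by
    have : (0 : ℝ) < n := lt_of_lt_of_le (by positivity) hn
    exact_mod_cast this
  set s : ℝ := n * δ ^ 2 with hs
  have hs0 : 0 < s := by positivity
  have hn' : C * Real.log (1 / ε) ≤ s := by
    have e : C * (δ ^ 2)⁻¹ * Real.log (1 / ε) = C * Real.log (1 / ε) / δ ^ 2 := by ring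
    rw [e, div_le_iff₀ (by positivity)] at hn
    exact hn
  have hε' : ∀ b, 0 < b → b ≤ C → Real.exp (-(s / b)) ≤ ε := by
    intro b hb hbC
    rw [← Real.le_log_iff_exp_le hε]
    rw [one_div, Real.log_inv] at hn' hL
    rw [neg_le, le_div_iff₀ hb]
    nlinarith
  rcases le_total M s with h | h
  · have h1 := htail (gaussianReal 0 1) isNormalizedSubgaussian_gaussianReal n
      (fun _ : Fin 1 => (1 : ℝ)) δ hδ hδ1
    simp only [Finset.univ_unique, Fin.default_eq_zero, Finset.sum_singleton, one_pow,
      mul_one] at h1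
    refine h1.trans (le_trans ?_ (hε' (2 / c) (by positivity) (le_max_left _ _)))
    have h2 : 2 * Real.log 2 / c ≤ s := (le_max_right _ _).trans h
    rw [div_le_iff₀ hc] at h2
    calc 2 * Real.exp (-(c * n * δ ^ 2)) = Real.exp (Real.log 2 + -(c * n * δ ^ 2)) := by
          rw [Real.exp_add, Real.exp_log (by norm_num)]
      _ ≤ _ := by
        apply Real.exp_le_exp.2
        have : s / (2 / c) = s * c / 2 := by field_simp
        rw [this]
        have : c * n * δ ^ 2 = s * c := by rw [hs]; ring
        linarith
  · have h1 := gaussian_sq_near_mean_ge hn0 hδ hδ1 hM1 h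
    have hmeas : MeasurableSet {y : Fin n → ℝ | |∑ i, y i ^ 2 - n| ≤ n * δ} :=
      measurableSet_le (by fun_prop) (by fun_prop)
    rw [← (hasLaw_arrayLaw_column (gaussianReal 0 1) n).measureReal_eq hmeas] at h1
    have hmeas' : MeasurableSet
        {x : Fin n → Fin 1 → ℝ | |∑ i, x i 0 ^ 2 - n| ≤ n * δ} :=
      measurableSet_le (by fun_prop) (by fun_prop)
    have h2 := probReal_compl_eq_one_sub (μ := arrayLaw (gaussianReal 0 1) n (Fin 1)) hmeas'
    have h3 : {x : Fin n → Fin 1 → ℝ | |∑ i, x i 0 ^ 2 - n| ≤ n * δ}ᶜ =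
        {x : Fin n → Fin 1 → ℝ | (n : ℝ) * δ < |∑ i, x i 0 ^ 2 - n|} := by
      ext x
      simp
    rw [h3] at h2
    rw [h2]
    refine le_trans ?_ (hε' (4 * (8 + M) * M) (by positivity) (le_max_right _ _))
    have := Real.add_one_le_exp (-(s / (4 * (8 + M) * M)))
    linarith

/-! ### The uniform law on the sphere as a normalized Gaussian -/

/-- The standard Gaussian measure on `ℝⁿ` has a radial density. -/
theorem exists_map_toLp_gaussian_eq_withDensity (n : ℕ) :
    ∃ ρ : ℝ → ℝ≥0∞, Measurable ρ ∧
      (Measure.pi fun _ : Fin n => gaussianReal 0 1).map (WithLp.toLp 2) =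
        (volume : Measure (EuclideanSpace ℝ (Fin n))).withDensity fun v => ρ ‖v‖ := by
  refine ⟨fun r => ENNReal.ofReal ((Real.sqrt (2 * Real.pi))⁻¹ ^ n * Real.exp (-r ^ 2 / 2)),
    by fun_prop, ?_⟩
  have h1 : (Measure.pi fun _ : Fin n => gaussianReal 0 1) =
      (volume : Measure (Fin n → ℝ)).withDensity fun x => ∏ i, gaussianPDF 0 1 (x i) := by
    rw [gaussianReal_of_var_ne_zero _ one_ne_zero, volume_pi]
    have : SigmaFinite ((volume : Measure ℝ).withDensity (gaussianPDF 0 1)) := by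
      rw [← gaussianReal_of_var_ne_zero _ one_ne_zero]; infer_instance
    exact pi_withDensity_eq (volume : Measure ℝ) (measurable_gaussianPDF _ _)
  have h2 : ∀ x : Fin n → ℝ, ∏ i, gaussianPDF 0 1 (x i) =
      ENNReal.ofReal ((Real.sqrt (2 * Real.pi))⁻¹ ^ n *
        Real.exp (-‖(WithLp.toLp 2 x : EuclideanSpace ℝ (Fin n))‖ ^ 2 / 2)) := by
    intro x
    simp only [gaussianPDF]
    rw [← ENNReal.ofReal_prod_of_nonneg fun i _ => gaussianPDFReal_nonneg _ _ _]
    congr 1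
    simp only [gaussianPDFReal]
    rw [Finset.prod_mul_distrib, ← Real.exp_sum, EuclideanSpace.real_norm_sq_eq]
    congr 1
    · simp
    · congr 1
      simp [Finset.sum_neg_distrib, ← Finset.sum_div, neg_div]
  ext s hs
  rw [Measure.map_apply (by fun_prop) hs, h1,
    withDensity_apply _ (hs.preimage (by fun_prop)), withDensity_apply _ hs]
  simp only [h2]
  exact (PiLp.volume_preserving_toLp (Fin n)).setLIntegral_comp_preimage hs
    (f := fun v => ENNReal.ofReal ((Real.sqrt (2 * Real.pi))⁻¹ ^ n * Real.exp (-‖v‖ ^ 2 / 2)))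
    (by fun_prop)

/-- In polar coordinates a radial density makes the measure a product, so the direction has law
proportional to the surface measure. Total mass one fixes the radial integral without computing it.
-/
theorem map_normalize_gaussian_eq_uniformSphere {n : ℕ} (hn : 0 < n) :
    (Measure.pi fun _ : Fin n => gaussianReal 0 1).map
      (fun g => ‖(WithLp.toLp 2 g : EuclideanSpace ℝ (Fin n))‖⁻¹ •
        (WithLp.toLp 2 g : EuclideanSpace ℝ (Fin n))) = uniformSphere n := by
  have : Nonempty (Fin n) := ⟨⟨0, hn⟩⟩
  set E := EuclideanSpace ℝ (Fin n)
  obtain ⟨ρ, hρ, hdens⟩ := exists_map_toLp_gaussian_eq_withDensity n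
  set γ := Measure.pi fun _ : Fin n => gaussianReal 0 1 with hγ
  set σ := (volume : Measure E).toSphere with hσ
  set τ := Measure.volumeIoiPow (Module.finrank ℝ E - 1) with hτ
  have hN : Measurable fun v : E => ‖v‖⁻¹ • v := by fun_prop
  have key : ∀ s : Set E, MeasurableSet s →
      γ.map (fun g => ‖(WithLp.toLp 2 g : E)‖⁻¹ • (WithLp.toLp 2 g : E)) s =
        σ (Subtype.val ⁻¹' s) * ∫⁻ r, ρ r.1 ∂τ := by
    intro s hs
    have e1 : γ.map (fun g => ‖(WithLp.toLp 2 g : E)‖⁻¹ • (WithLp.toLp 2 g : E)) =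
        (γ.map (WithLp.toLp 2 : (Fin n → ℝ) → E)).map fun v => ‖v‖⁻¹ • v := by
      rw [Measure.map_map hN (by fun_prop)]; rfl
    rw [e1, hdens, Measure.map_apply hN hs, withDensity_apply _ (hN hs),
      ← lintegral_indicator (hN hs), ← restrict_compl_singleton (μ := volume) (0 : E),
      ← lintegral_subtype_comap (measurableSet_singleton _).compl]
    have hs' : MeasurableSet ((Subtype.val : Metric.sphere (0 : E) 1 → E) ⁻¹' s) :=
      measurable_subtype_coe hs
    have hf : Measurable fun p : Metric.sphere (0 : E) 1 × Set.Ioi (0 : ℝ) =>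
        ((Subtype.val : Metric.sphere (0 : E) 1 → E) ⁻¹' s).indicator (fun _ => (1 : ℝ≥0∞)) p.1
          * ρ p.2.1 := by
      refine Measurable.mul ?_ (by fun_prop)
      exact (measurable_const.indicator hs').comp measurable_fst
    rw [← one_mul (σ _), ← lintegral_indicator_const hs', ← lintegral_prod_mul
      (measurable_const.indicator hs').aemeasurable (by fun_prop),
      ← (Measure.measurePreserving_homeomorphUnitSphereProd (volume : Measure E)).lintegral_comp hf]
    refine lintegral_congr fun v => ?_
    have hv1 : ((homeomorphUnitSphereProd E v).1 : E) = ‖(v : E)‖⁻¹ • (v : E) := by simp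
    have hv2 : ((homeomorphUnitSphereProd E v).2 : ℝ) = ‖(v : E)‖ := by simp
    have hiff : (v : E) ∈ (fun v : E => ‖v‖⁻¹ • v) ⁻¹' s ↔
        (homeomorphUnitSphereProd E v).1 ∈
          (Subtype.val : Metric.sphere (0 : E) 1 → E) ⁻¹' s := by
      rw [Set.mem_preimage, Set.mem_preimage, hv1]
    by_cases h : (v : E) ∈ (fun v : E => ‖v‖⁻¹ • v) ⁻¹' s
    · rw [Set.indicator_of_mem h, Set.indicator_of_mem (hiff.1 h), hv2, one_mul]
    · rw [Set.indicator_of_notMem h, Set.indicator_of_notMem (fun h' => h (hiff.2 h')), zero_mul]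
  have htot := key Set.univ MeasurableSet.univ
  have : IsProbabilityMeasure
      (γ.map (fun g => ‖(WithLp.toLp 2 g : E)‖⁻¹ • (WithLp.toLp 2 g : E))) :=
    Measure.isProbabilityMeasure_map (Measurable.aemeasurable (by fun_prop))
  rw [measure_univ, Set.preimage_univ, mul_comm] at htot
  have hR : ∫⁻ r, ρ r.1 ∂τ = (σ Set.univ)⁻¹ := ENNReal.eq_inv_of_mul_eq_one_left htot.symm
  ext s hs
  rw [key s hs, hR, uniformSphere, Measure.map_apply measurable_subtype_coe hs,
    Measure.smul_apply, smul_eq_mul, mul_comm]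

/-! ### Column normalization and the spherical model -/

section specNorm

variable {ι : Type*} [Fintype ι] [DecidableEq ι]

theorem specNorm_nonneg (M : Matrix ι ι ℝ) : 0 ≤ specNorm M := norm_nonneg _

theorem specNorm_add_le (M P : Matrix ι ι ℝ) : specNorm (M + P) ≤ specNorm M + specNorm P := by
  unfold specNorm
  rw [map_add]
  exact norm_add_le _ _

theorem specNorm_mul_le (M P : Matrix ι ι ℝ) : specNorm (M * P) ≤ specNorm M * specNorm P := by
  unfold specNorm
  rw [map_mul]
  exact norm_mul_le _ _

theorem specNorm_diagonal_le {d : ι → ℝ} {c : ℝ} (hc : 0 ≤ c) (hd : ∀ i, |d i| ≤ c) :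
    specNorm (Matrix.diagonal d) ≤ c := by
  refine ContinuousLinearMap.opNorm_le_bound _ hc fun x => ?_
  refine le_of_sq_le_sq ?_ (by positivity)
  rw [mul_pow, EuclideanSpace.real_norm_sq_eq, EuclideanSpace.real_norm_sq_eq, Finset.mul_sum]
  refine Finset.sum_le_sum fun i _ => ?_
  rw [Matrix.ofLp_toEuclideanCLM, Matrix.mulVec_diagonal, mul_pow]
  exact mul_le_mul_of_nonneg_right
    (sq_le_sq' (by linarith [(abs_le.1 (hd i)).1]) (abs_le.1 (hd i)).2) (sq_nonneg _)

theorem abs_apply_self_le_specNorm (M : Matrix ι ι ℝ) (i : ι) : |M i i| ≤ specNorm M := by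
  have h1 := (Matrix.toEuclideanCLM (n := ι) (𝕜 := ℝ) M).le_opNorm (EuclideanSpace.single i 1)
  rw [PiLp.norm_single, norm_one, mul_one] at h1
  refine le_trans ?_ h1
  have h2 := PiLp.norm_apply_le
    (Matrix.toEuclideanCLM (n := ι) (𝕜 := ℝ) M (EuclideanSpace.single i 1)) i
  rw [Real.norm_eq_abs, Matrix.ofLp_toEuclideanCLM] at h2
  simpa using h2

theorem continuous_specNorm : Continuous (specNorm : Matrix ι ι ℝ → ℝ) := by
  let f : Matrix ι ι ℝ →ₗ[ℝ] (EuclideanSpace ℝ ι →L[ℝ] EuclideanSpace ℝ ι) :=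
    { toFun := Matrix.toEuclideanCLM (n := ι) (𝕜 := ℝ)
      map_add' := map_add _
      map_smul' := map_smul _ }
  exact continuous_norm.comp f.continuous_of_finiteDimensional

end specNorm

/-- Normalizing the columns of a near-isometry at most quadruples its isometry constant. -/
theorem isoConst_normalize_le {n N : ℕ} (B : Matrix (Fin n) (Fin N) ℝ) (T : Finset (Fin N))
    {η : ℝ} (hη : η ≤ 1 / 2) (hB : isoConst B T ≤ η) :
    isoConst (Matrix.of fun i j => (Real.sqrt (∑ i, B i j ^ 2))⁻¹ * B i j) T ≤ 4 * η := by
  set M := (colSubmatrix B T)ᵀ * colSubmatrix B T - 1 with hM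
  have hη0 : 0 ≤ η := (specNorm_nonneg _).trans hB
  set w : T → ℝ := fun j => ∑ i, B i j ^ 2 with hw
  have hMw : ∀ j : T, M j j = w j - 1 := fun j => by
    rw [hM, Matrix.sub_apply, Matrix.one_apply_eq, Matrix.mul_apply, hw]
    congr 1
    exact Finset.sum_congr rfl fun i _ => by rw [pow_two]; rfl
  have hw1 : ∀ j, |w j - 1| ≤ η := fun j => by
    rw [← hMw]; exact (abs_apply_self_le_specNorm M j).trans hB
  have hwpos : ∀ j, 1 / 2 ≤ w j := fun j => by linarith [(abs_le.1 (hw1 j)).1]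
  set d : T → ℝ := fun j => (Real.sqrt (w j))⁻¹ with hd
  have hd2 : ∀ j, d j ^ 2 = (w j)⁻¹ := fun j => by
    rw [hd, inv_pow, Real.sq_sqrt (by linarith [hwpos j])]
  have hdw : ∀ j, (w j)⁻¹ ≤ 2 := fun j => by
    rw [inv_le_comm₀ (by linarith [hwpos j]) (by norm_num)]
    linarith [hwpos j]
  have hdle : ∀ j, |d j| ≤ Real.sqrt 2 := fun j => by
    apply Real.abs_le_sqrt
    rw [hd2]; exact hdw j
  have hcol : colSubmatrix (Matrix.of fun i j => (Real.sqrt (∑ i, B i j ^ 2))⁻¹ * B i j) T =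
      colSubmatrix B T * Matrix.diagonal d := by
    ext i j
    rw [Matrix.mul_diagonal, mul_comm]
    rfl
  -- With `D` the diagonal of inverse column norms, `D (M + 1) D - 1 = D M D + (D² - 1)`. Squared
  -- norms are at least `1/2`, so each summand is at most `2η`.
  have hdecomp : (Matrix.diagonal d)ᵀ * ((colSubmatrix B T)ᵀ * colSubmatrix B T) *
      Matrix.diagonal d - 1 = Matrix.diagonal d * M * Matrix.diagonal d +
        Matrix.diagonal (fun j => d j ^ 2 - 1) := by
    rw [hM, Matrix.mul_sub, Matrix.sub_mul, Matrix.mul_one, Matrix.diagonal_mul_diagonal,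
      Matrix.diagonal_transpose]
    have : Matrix.diagonal (fun j => d j ^ 2 - 1) =
        Matrix.diagonal (fun j => d j * d j) - (1 : Matrix T T ℝ) := by
      rw [← Matrix.diagonal_one, Matrix.diagonal_sub]
      simp [pow_two]
    rw [this]
    abel
  have h1 : specNorm (Matrix.diagonal d) ≤ Real.sqrt 2 :=
    specNorm_diagonal_le (Real.sqrt_nonneg 2) hdle
  have h2 : specNorm (Matrix.diagonal fun j => d j ^ 2 - 1) ≤ 2 * η := by
    refine specNorm_diagonal_le (by positivity) fun j => ?_
    have hwj : 0 < w j := by linarith [hwpos j]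
    have : d j ^ 2 - 1 = (w j)⁻¹ * -(w j - 1) := by
      rw [hd2]; field_simp; ring
    rw [this, abs_mul, abs_neg, abs_of_pos (inv_pos.2 hwj)]
    exact mul_le_mul (hdw j) (hw1 j) (abs_nonneg _) (by norm_num)
  unfold isoConst
  rw [hcol, Matrix.transpose_mul, show (Matrix.diagonal d)ᵀ * (colSubmatrix B T)ᵀ *
    (colSubmatrix B T * Matrix.diagonal d) = (Matrix.diagonal d)ᵀ *
      ((colSubmatrix B T)ᵀ * colSubmatrix B T) * Matrix.diagonal d by
        simp only [Matrix.mul_assoc], hdecomp]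
  calc _ ≤ specNorm (Matrix.diagonal d * M * Matrix.diagonal d) + 2 * η :=
        (specNorm_add_le _ _).trans (by gcongr)
    _ ≤ Real.sqrt 2 * η * Real.sqrt 2 + 2 * η := by
        gcongr
        refine (specNorm_mul_le _ _).trans ?_
        refine mul_le_mul ?_ h1 (specNorm_nonneg _) (by positivity)
        refine (specNorm_mul_le _ _).trans ?_
        exact mul_le_mul h1 hB (specNorm_nonneg _) (by positivity)
    _ = 4 * η := by
        have := Real.mul_self_sqrt (show (0 : ℝ) ≤ 2 by norm_num)
        linear_combination η * this

theorem measurable_isoConst_of_columns {n N : ℕ} (T : Finset (Fin N)) :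
    Measurable fun y : Fin N → EuclideanSpace ℝ (Fin n) =>
      isoConst (Matrix.of fun i j => y j i) T := by
  refine Continuous.measurable (continuous_specNorm.comp ?_)
  have h : Continuous fun y : Fin N → EuclideanSpace ℝ (Fin n) =>
      colSubmatrix (Matrix.of fun i j => y j i) T := by
    refine continuous_matrix fun i j => ?_
    change Continuous fun y : Fin N → EuclideanSpace ℝ (Fin n) => y j.1 i
    fun_prop
  exact (h.matrix_transpose.matrix_mul h).sub continuous_const

theorem hasLaw_transpose_arrayLaw (ν : Measure ℝ) [IsProbabilityMeasure ν] (n N : ℕ) :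
    HasLaw (fun (y : Fin N → Fin n → ℝ) i j => y j i) (arrayLaw ν n (Fin N))
      (arrayLaw ν N (Fin n)) :=
  hasLaw_array (Φ := fun (y : Fin N → Fin n → ℝ) i j => y j i)
    (fun i j => hasLaw_arrayLaw_eval ν N n j i)
    ((iIndepFun_arrayLaw ν N n).precomp (g := Prod.swap) Prod.swap_injective)

/-- A spherical matrix has the law of a Gaussian matrix with normalized columns. -/
theorem IsSphericalMatrix.measureReal_isoConst_le {Ω : Type*} [MeasurableSpace Ω] {μ : Measure Ω}
    [IsProbabilityMeasure μ] {n N : ℕ} (hn : 0 < n) {A : Ω → Matrix (Fin n) (Fin N) ℝ}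
    (hA : IsSphericalMatrix μ A) (T : Finset (Fin N)) {δ : ℝ} (hδ1 : δ ≤ 1) :
    μ.real {ω | δ < isoConst (A ω) T} ≤ (arrayLaw (gaussianReal 0 1) n (Fin N)).real
        {x | δ / 4 < isoConst ((1 / Real.sqrt n) • (Matrix.of x : Matrix (Fin n) (Fin N) ℝ)) T} := by
  set E := EuclideanSpace ℝ (Fin n)
  set nrm : (Fin n → ℝ) → E := fun g => ‖(WithLp.toLp 2 g : E)‖⁻¹ • (WithLp.toLp 2 g : E) with hnrm
  have hnrmm : Measurable nrm := by fun_prop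
  have hmap : (Measure.pi fun _ : Fin n => gaussianReal 0 1).map nrm = uniformSphere n :=
    map_normalize_gaussian_eq_uniformSphere hn
  have hprob : IsProbabilityMeasure (uniformSphere n) := by
    rw [← hmap]; exact Measure.isProbabilityMeasure_map hnrmm.aemeasurable
  have hcol : HasLaw (fun ω j => (WithLp.toLp 2 fun i => A ω i j : E))
      (Measure.pi fun _ : Fin N => uniformSphere n) μ := by
    refine ⟨aemeasurable_pi_lambda _ fun j => (hA.1 j).aemeasurable, ?_⟩
    rw [(iIndepFun_iff_map_fun_eq_pi_map fun j => (hA.1 j).aemeasurable).1 hA.2]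
    simp only [(hA.1 _).map_eq]
  -- The Gaussian array is indexed columns first, so that normalization acts coordinatewise on a
  -- product measure; it is transposed afterwards.
  have hgauss : HasLaw (fun (y : Fin N → Fin n → ℝ) j => nrm (y j))
      (Measure.pi fun _ : Fin N => uniformSphere n) (arrayLaw (gaussianReal 0 1) N (Fin n)) := by
    refine ⟨Measurable.aemeasurable (by fun_prop), ?_⟩
    rw [arrayLaw, Measure.pi_map_pi (f := fun _ => nrm) fun _ => hnrmm.aemeasurable, hmap]
  have hmeas : MeasurableSet {y : Fin N → E | δ < isoConst (Matrix.of fun i j => y j i) T} :=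
    measurableSet_lt measurable_const (measurable_isoConst_of_columns T)
  have e1 : μ.real {ω | δ < isoConst (A ω) T} = (Measure.pi fun _ : Fin N => uniformSphere n).real
      {y : Fin N → E | δ < isoConst (Matrix.of fun i j => y j i) T} :=
    hcol.measureReal_eq hmeas
  rw [e1, ← hgauss.measureReal_eq hmeas]
  refine le_trans (measureReal_mono (fun y hy => ?_) (measure_ne_top _ _))
    (measureReal_preimage_le_of_hasLaw (hasLaw_transpose_arrayLaw (gaussianReal 0 1) n N) _)
  by_contra hcon
  have hcon' : isoConst ((1 / Real.sqrt n) •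
    (Matrix.of fun i j => y j i : Matrix (Fin n) (Fin N) ℝ)) T ≤ δ / 4 := not_lt.1 hcon
  have h1 := isoConst_normalize_le _ T (by linarith) hcon'
  have hn0 : (0 : ℝ) < n := by exact_mod_cast hn
  have hs0 : 0 < Real.sqrt n := Real.sqrt_pos.2 hn0
  -- The factor `1/√n` cancels under normalization.
  have e2 : (Matrix.of fun i j => (Real.sqrt (∑ i, ((1 / Real.sqrt n) •
      (Matrix.of fun i j => y j i : Matrix (Fin n) (Fin N) ℝ)) i j ^ 2))⁻¹ *
      ((1 / Real.sqrt n) • (Matrix.of fun i j => y j i : Matrix (Fin n) (Fin N) ℝ)) i j) =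
      Matrix.of fun i j => nrm (y j) i := by
    ext i j
    simp only [Matrix.of_apply, Matrix.smul_apply, smul_eq_mul, mul_pow, ← Finset.mul_sum]
    rw [Real.sqrt_mul (by positivity), Real.sqrt_sq (by positivity), hnrm]
    simp only [PiLp.smul_apply, smul_eq_mul, EuclideanSpace.norm_eq, Real.norm_eq_abs, sq_abs]
    field_simp
  rw [e2] at h1
  have hy' : δ < isoConst (Matrix.of fun i j => nrm (y j) i) T := hy
  linarith

theorem ae_norm_eq_one_uniformSphere (n : ℕ) : ∀ᵐ v ∂uniformSphere n, ‖v‖ = 1 := by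
  have hm : MeasurableSet {v : EuclideanSpace ℝ (Fin n) | ‖v‖ = 1} :=
    measurableSet_eq_fun (by fun_prop) measurable_const
  rw [uniformSphere, ae_map_iff measurable_subtype_coe.aemeasurable hm]
  exact Filter.Eventually.of_forall fun v => by simp

theorem IsSphericalMatrix.deltaStar_tail_card_one {Ω : Type*} [MeasurableSpace Ω] {μ : Measure Ω}
    {n : ℕ} {A : Ω → Matrix (Fin n) (Fin 1) ℝ}
    (hA : IsSphericalMatrix μ A) (S : Finset (Fin 1)) {δ : ℝ} (hδ : 0 ≤ δ) :
    μ.real {ω | δ < deltaStar (A ω) S} = 0 := by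
  have hm : Measurable fun v : EuclideanSpace ℝ (Fin n) => ‖v‖ = 1 :=
    measurableSet_setOfPred.1 (measurableSet_eq_fun (by fun_prop) measurable_const)
  have hae := ((hA.1 0).ae_iff hm).2 (ae_norm_eq_one_uniformSphere n)
  rw [measureReal_def, measure_mono_null ?_ hae, ENNReal.toReal_zero]
  intro ω hω hcon
  refine absurd (deltaStar_le_of_card_one _ S hδ ?_) (not_le.2 hω)
  have h1 : ‖(WithLp.toLp 2 fun i => A ω i 0 : EuclideanSpace ℝ (Fin n))‖ = 1 := hcon
  have h2 : ∑ i, A ω i 0 ^ 2 = 1 := by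
    have h3 := EuclideanSpace.real_norm_sq_eq
      (WithLp.toLp 2 fun i => A ω i 0 : EuclideanSpace ℝ (Fin n))
    rw [h1, one_pow] at h3
    exact h3.symm
  rw [h2]
  simpa using hδ

/-! ### Assembly of the cases -/

theorem measureReal_deltaStar_le_eq_one {Ω : Type*} [MeasurableSpace Ω] (μ : Measure Ω)
    [IsProbabilityMeasure μ] {n : ℕ} (A : Ω → Matrix (Fin n) (Fin 0) ℝ) (S : Finset (Fin 0))
    {δ : ℝ} (hδ : 0 ≤ δ) : μ.real {ω | deltaStar (A ω) S ≤ δ} = 1 := by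
  have h : {ω | deltaStar (A ω) S ≤ δ} = Set.univ :=
    Set.eq_univ_of_forall fun ω => deltaStar_le_of_forall hδ fun ℓ => ℓ.elim0
  rw [h, probReal_univ]

theorem deltaStar_tail_of_entries {δ c : ℝ} {n N : ℕ} {S : Finset (Fin N)}
    (h : ∀ (ν : Measure ℝ) [IsProbabilityMeasure ν], IsNormalizedSubgaussian ν →
      (arrayLaw ν n (Fin N)).real
        {x | δ < deltaStar ((1 / Real.sqrt n) • (Matrix.of x : Matrix (Fin n) (Fin N) ℝ)) S} ≤ c)
    {Ω : Type*} [MeasurableSpace Ω] {μ : Measure Ω} [IsProbabilityMeasure μ]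
    {Φ : Ω → Matrix (Fin n) (Fin N) ℝ} (hΦ : IsGaussianMatrix μ Φ ∨ IsBernoulliMatrix μ Φ) :
    μ.real {ω | δ < deltaStar ((1 / Real.sqrt (n : ℝ)) • Φ ω) S} ≤ c := by
  rcases hΦ with hΦ | hΦ
  · exact (measureReal_preimage_le_of_hasLaw (hasLaw_array (Φ := Φ) hΦ.1 hΦ.2) _).trans
      (h (gaussianReal 0 1) isNormalizedSubgaussian_gaussianReal)
  · exact (measureReal_preimage_le_of_hasLaw (hasLaw_array (Φ := Φ) hΦ.1 hΦ.2) _).trans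
      (h signMeasure isNormalizedSubgaussian_signMeasure)

theorem IsGaussianMatrix.deltaStar_tail_card_one {δ ε : ℝ} {n : ℕ} (hn : 0 < n) (hδ : 0 ≤ δ)
    (h : (arrayLaw (gaussianReal 0 1) n (Fin 1)).real
      {x | n * δ < |∑ i, x i 0 ^ 2 - n|} ≤ ε)
    {Ω : Type*} [MeasurableSpace Ω] {μ : Measure Ω} [IsProbabilityMeasure μ]
    {Φ : Ω → Matrix (Fin n) (Fin 1) ℝ} (hΦ : IsGaussianMatrix μ Φ) (S : Finset (Fin 1)) :
    μ.real {ω | δ < deltaStar ((1 / Real.sqrt (n : ℝ)) • Φ ω) S} ≤ ε := by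
  refine le_trans (measureReal_mono (fun ω hω => ?_) (measure_ne_top _ _))
    ((measureReal_preimage_le_of_hasLaw (hasLaw_array (Φ := Φ) hΦ.1 hΦ.2) _).trans h)
  by_contra hcon
  have hcon' : |∑ i, Φ ω i 0 ^ 2 - n| ≤ n * δ := not_lt.1 hcon
  refine absurd (deltaStar_le_of_card_one _ S hδ ?_) (not_le.2 hω)
  have hn0 : (0 : ℝ) < n := by exact_mod_cast hn
  have e : ∑ i, ((1 / Real.sqrt (n : ℝ)) • Φ ω) i 0 ^ 2 - 1 =
      (∑ i, Φ ω i 0 ^ 2 - n) / n := by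
    simp only [Matrix.smul_apply, smul_eq_mul, mul_pow, ← Finset.mul_sum, div_pow,
      Real.sq_sqrt hn0.le]
    field_simp
  rw [e, abs_div, abs_of_pos hn0, div_le_iff₀ hn0, mul_comm δ]
  exact hcon'

theorem sample_size_mono {C C' δ M : ℝ} {n : ℕ} (hC : C' ≤ C) (hM : 0 ≤ M)
    (h : C * (δ ^ 2)⁻¹ * M ≤ n) : C' * (δ ^ 2)⁻¹ * M ≤ n := by
  refine le_trans ?_ h
  have : 0 ≤ (δ ^ 2)⁻¹ := by positivity
  gcongr

theorem mainTheorem8 (δ₀ : ℝ) (hδ₀ : 0 < δ₀) (hδ₀1 : δ₀ < 1) :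
    (∃ C : ℝ, 0 < C ∧
      ∀ (n N k : ℕ) (S : Finset (Fin N)) (δ ε : ℝ) (Ω : Type*) [MeasurableSpace Ω]
        (μ : Measure Ω) [IsProbabilityMeasure μ] (Φ : Ω → Matrix (Fin n) (Fin N) ℝ),
        S.card = k → 0 < δ → δ ≤ δ₀ → 0 < ε →
        (IsGaussianMatrix μ Φ ∨ IsBernoulliMatrix μ Φ) →
        C * (δ ^ 2)⁻¹ * max ((k : ℝ) * Real.log (1 / δ)) (Real.log ((N : ℝ) / ε)) ≤ (n : ℝ) →
        1 - ε ≤ μ.real {ω | deltaStar ((1 / Real.sqrt (n : ℝ)) • Φ ω) S ≤ δ}) ∧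
    (∃ C : ℝ, 0 < C ∧
      ∀ (n N k : ℕ) (S : Finset (Fin N)) (δ ε : ℝ) (Ω : Type*) [MeasurableSpace Ω]
        (μ : Measure Ω) [IsProbabilityMeasure μ] (A : Ω → Matrix (Fin n) (Fin N) ℝ),
        S.card = k → 0 < δ → δ ≤ δ₀ → 0 < ε →
        IsSphericalMatrix μ A →
        C * (δ ^ 2)⁻¹ * max ((k : ℝ) * Real.log (1 / δ)) (Real.log ((N : ℝ) / ε)) ≤ (n : ℝ) →
        1 - ε ≤ μ.real {ω | deltaStar (A ω) S ≤ δ}) := by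
  constructor
  · obtain ⟨c, hc, htail⟩ := exists_deltaStar_tail
    obtain ⟨C₁, hC₁, hunion⟩ := exists_const_union_bound_le hδ₀ hδ₀1 hc
    obtain ⟨C₂, hC₂, hcolumn⟩ := exists_const_gaussian_column hδ₀1
    refine ⟨max C₁ C₂, lt_max_of_lt_left hC₁, ?_⟩
    intro n N k S δ ε Ω _ μ _ Φ hS hδ hδδ₀ hε hΦ hn
    rcases le_or_gt 1 ε with hε1 | hε1
    · exact (sub_nonpos.2 hε1).trans measureReal_nonneg
    rcases Nat.lt_trichotomy N 1 with hN | rfl | hN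
    · obtain rfl : N = 0 := by omega
      rw [measureReal_deltaStar_le_eq_one μ _ S hδ.le]
      linarith
    · have hL : 0 < Real.log (((1 : ℕ) : ℝ) / ε) := by
        apply Real.log_pos
        rw [lt_div_iff₀ hε]
        simpa using hε1
      have hM := hL.trans_le (le_max_right ((k : ℝ) * Real.log (1 / δ)) _)
      have hn0 : 0 < n := by
        have : (0 : ℝ) < n := lt_of_lt_of_le (by positivity) hn
        exact_mod_cast this
      refine one_sub_le_measureReal_deltaStar_le μ _ S ?_
      rcases hΦ with hΦ | hΦ
      · refine hΦ.deltaStar_tail_card_one hn0 hδ.le ?_ S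
        refine hcolumn n δ ε hδ hδδ₀ hε hε1 ?_
        have h1 := sample_size_mono (le_max_right C₁ C₂) hM.le hn
        refine le_trans ?_ h1
        rw [Nat.cast_one]
        gcongr
        exact le_max_right _ _
      · rw [hΦ.deltaStar_tail_card_one hn0 S hδ.le]
        exact hε.le
    · have hL : 0 ≤ Real.log ((N : ℝ) / ε) := by
        apply Real.log_nonneg
        have hN' : (1 : ℝ) < N := by exact_mod_cast hN
        rw [le_div_iff₀ hε]
        linarith
      obtain ⟨hn0, hle⟩ := hunion n N k δ ε hN hδ hδδ₀ hε hε1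
        (sample_size_mono (le_max_left C₁ C₂) (hL.trans (le_max_right _ _)) hn)
      refine one_sub_le_measureReal_deltaStar_le μ _ S (le_trans ?_ hle)
      rw [← hS]
      exact deltaStar_tail_of_entries
        (fun ν _ hν => htail ν hν n N S δ hn0 hδ (hδδ₀.trans hδ₀1.le)) hΦ
  · obtain ⟨c, hc, htail⟩ := exists_isoConst_tail
    -- The Gaussian tail is used at `δ / 4` to pay for normalization.
    obtain ⟨C, hC, hunion⟩ := exists_const_union_bound_le (c := c / 16) hδ₀ hδ₀1 (by positivity)
    refine ⟨C, hC, ?_⟩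
    intro n N k S δ ε Ω _ μ _ A hS hδ hδδ₀ hε hA hn
    rcases le_or_gt 1 ε with hε1 | hε1
    · exact (sub_nonpos.2 hε1).trans measureReal_nonneg
    rcases Nat.lt_trichotomy N 1 with hN | rfl | hN
    · obtain rfl : N = 0 := by omega
      rw [measureReal_deltaStar_le_eq_one μ _ S hδ.le]
      linarith
    · refine one_sub_le_measureReal_deltaStar_le μ _ S ?_
      rw [hA.deltaStar_tail_card_one S hδ.le]
      exact hε.le
    · have hδ1 : δ ≤ 1 := hδδ₀.trans hδ₀1.le
      obtain ⟨hn0, hle⟩ := hunion n N k δ ε hN hδ hδδ₀ hε hε1 hn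
      refine one_sub_le_measureReal_deltaStar_le μ _ S (le_trans ?_ hle)
      refine measureReal_deltaStar_gt_le μ A S hδ.le (fun ℓ hℓ => ?_) (by positivity)
      refine (hA.measureReal_isoConst_le hn0 _ hδ1).trans ?_
      refine (htail (gaussianReal 0 1) isNormalizedSubgaussian_gaussianReal n N _ (δ / 4) hn0
        (by positivity) (by linarith)).trans_eq ?_
      rw [Finset.card_insert_of_notMem hℓ, hS]
      congr 3
      ring
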